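/- **Setting.** Let $(X,d)$ be a compact metric space with a finite non-zero Borel measure $\omega$, and let $1<p<\infty$, $p\neq 2$, $\varepsilon>0$. Let $\Omega_X$ be the set of continuous maps $F:X\to X$ with $F_\#\omega\ll\omega$ for which the Koopman operator $\mathcal K_Ff=f\circ F$ is bounded on $L^p(X,\omega)$, and let $\Omega_X^m\subset\Omega_X$ be the set of continuous $F$ with $F_\#\omega=\omega$. Put $$\sigma_{\mathrm{ap}}(\mathcal K_F)=\{\lambda\in\mathbb C:\exists (f_n)\subset L^p,\ \|f_n\|_p=1,\ \|(\mathcal K_F-\lambda)f_n\|_p\to0\},$$ $$\sigma_{\mathrm{ap},\varepsilon}(\mathcal K_F)=\overline{\{\lambda\in\mathbb C:\exists f\in L^p,\ \|f\|_p=1,\ \|(\mathcal K_F-\lambda)f\|_p<\varepsilon\}}.$$ Both are elements of $\mathcal M_H$, the non-empty compact subsets of $\mathbb C$ with the Hausdorff metric $d_H$. **Computational problems.** For $\Omega\in\{\Omega_X,\Omega_X^m\}$ and $\Xi\in\{\sigma_{\mathrm{ap}},\sigma_{\mathrm{ap},\varepsilon}\}$ consider the problem of computing $\Xi(\mathcal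 K_F)$, $F\in\Omega$, from the point evaluations $\Lambda=\{F\mapsto F(x):x\in X\}$ with $\Delta_1$-information: an input is any table $A=(a_{x,n})_{x\in X,n\in\mathbb N}$ in $X$ such that for some $F\in\Omega$ one has $d(a_{x,n},F(x))\le2^{-n}$ for all $x,n$; its value is $\Xi(A):=\Xi(\mathcal K_F)$; the readable evaluations are the entries $a_{x,n}$. A *general algorithm* is a map $\Gamma$ from inputs to $\mathcal M_H$ such that to each input $A$ belongs a non-empty finite set $\Lambda_\Gamma(A)$ of evaluations, and whenever an input $B$ agrees with $A$ on $\Lambda_\Gamma(A)$, then $\Lambda_\Gamma(B)=\Lambda_\Gamma(A)$ and $\Gamma(B)=\Gamma(A)$. A *tower of height $k$* is a family of maps $\Gamma_{n_k},\Gamma_{n_k,n_{k-1}},\dots,\Gamma_{n_k,\dots,n_1}$ from inputs to $\mathcal M_H$, the last ones being general algorithms, with $\Xi(A)=\lim_{n_k}\Gamma_{n_k}(A)$, $\Gamma_{n_k}(A)=\lim_{n_{k-1}}\Gamma_{n_k,n_{k-1}}(A)$, …, for every input $A$. For $k\ge1$ the problem belongs to $\Sigma_k^G$ if there are a tower of height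 $k$ and sets $X_n(A)\in\mathcal M_H$ such that $\Gamma_{n}(A)\subset X_{n}(A)$ and $d_H(X_{n}(A),\Xi(A))\le2^{-n}$ for all $A$ and all $n=n_k$. It belongs to $\Pi_k^G$ if there are a tower of height $k$ and sets $X_n(A)\in\mathcal M_H$ such that $\Xi(A)\subset X_{n}(A)$ and $d_H(X_{n}(A),\Gamma_{n}(A))\le2^{-n}$ for all $A$ and all $n=n_k$. **Upper bounds.** For all such $(X,d,\omega)$, $p$ and $\varepsilon$, both on $\Omega_X^m$ and on $\Omega_X$, the problem of computing $\sigma_{\mathrm{ap},\varepsilon}$ belongs to $\Sigma_2^G$ and the problem of computing $\sigma_{\mathrm{ap}}$ belongs to $\Pi_3^G$. **Sharpness.** Let $K\subset[0,1]$ be the middle-third Cantor set and $X^*=\mathbb T^1\times K$ with the product metric. There is a non-atomic Borel probability measure $\nu$ on $K$ such that, with $\omega^*=\lambda_{\mathbb T}\otimes\nu$ ($\lambda_{\mathbb T}$ the Haar probability measure on $\mathbb T^1$), for all $1<p<\infty$ with $p\ne2$ and all $\varepsilon>0$, both on $\Omega_{X^*}^m$ and on $\Omega_{X^*}$, the problem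 of computing $\sigma_{\mathrm{ap},\varepsilon}$ does not belong to $\Sigma_1^G$ and the problem of computing $\sigma_{\mathrm{ap}}$ does not belong to $\Pi_2^G$. -/

import Mathlib

open MeasureTheory Filter Topology TopologicalSpace
open scoped ENNReal NNReal

/-! ### Computational problems, general algorithms, towers, the SCI hierarchy -/

/-- A computational problem with values in the metric space `M`. The evaluation set is the indexed
family `eval`, whose members take their values in the metric space `V`; by `separates`, it
separates any two inputs at which the problem function `Xi` differs. -/
structure CompProblem.{u, v} (M : Type u) (V : Type v) where
  /-- the primary set -/
  Input : Type v
  /-- the index set of the evaluation set -/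
  Index : Type v
  /-- the evaluation set -/
  eval : Index → Input → V
  /-- the problem function -/
  Xi : Input → M
  separates : ∀ A B : Input, Xi A ≠ Xi B → ∃ i, eval i A ≠ eval i B

namespace CompProblem

variable {M V : Type*}

/-- `Γ` is a general algorithm: to every input `A` belongs a non-empty finite set `Q A` of
evaluations, and any input that agrees with `A` on `Q A` has the same set of evaluations and
the same output as `A`. -/
def IsGeneralAlgorithm (P : CompProblem M V) (Γ : P.Input → M) : Prop :=
  ∃ Q : P.Input → Finset P.Index,
    ∀ A, (Q A).Nonempty ∧
      ∀ B, (∀ i ∈ Q A, P.eval i A = P.eval i B) → Q A = Q B ∧ Γ A = Γ B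

/-- A tower of general algorithms of height `k`. For a list `l = [n_k, …, n_{j+1}]` of length
`k - j`, the function `Γ l` is `Γ_{n_k, …, n_{j+1}}`; lists longer than `k` play no role. -/
structure IsTower [MetricSpace M] (P : CompProblem M V) (k : ℕ)
    (Γ : List ℕ → P.Input → M) : Prop where
  base : ∀ l : List ℕ, l.length = k → P.IsGeneralAlgorithm (Γ l)
  lim : ∀ l : List ℕ, l.length < k → ∀ A,
    Tendsto (fun n : ℕ => Γ (l ++ [n]) A) atTop (𝓝 (Γ l A))
  top : ∀ A, Γ [] A = P.Xi A

/-- The solvability complexity index of `P` with respect to general towers is at most `k`. -/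
def SCILe [MetricSpace M] (P : CompProblem M V) (k : ℕ) : Prop :=
  ∃ j ≤ k, ∃ Γ : List ℕ → P.Input → M, P.IsTower j Γ

/-- The classes `Δ_k^G`. -/
def InDelta [MetricSpace M] (P : CompProblem M V) : ℕ → Prop
  | 0 => P.SCILe 0
  | 1 => ∃ Γ : ℕ → P.Input → M, (∀ n, P.IsGeneralAlgorithm (Γ n)) ∧
      ∀ n A, dist (Γ n A) (P.Xi A) ≤ (2 : ℝ)⁻¹ ^ n
  | k + 2 => P.SCILe (k + 1)

/-- The classes `Σ_m^G` for problems with values in the non-empty compact subsets of `ℂ`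
with the Hausdorff metric. -/
def InSigma (P : CompProblem (NonemptyCompacts ℂ) V) : ℕ → Prop
  | 0 => P.InDelta 0
  | m + 1 => P.InDelta (m + 2) ∧
      ∃ Γ : List ℕ → P.Input → NonemptyCompacts ℂ, P.IsTower (m + 1) Γ ∧
        ∃ X : ℕ → P.Input → NonemptyCompacts ℂ, ∀ A,
          (∀ n, (Γ [n] A : Set ℂ) ⊆ X n A) ∧
          Tendsto (fun n => Γ [n] A) atTop (𝓝 (P.Xi A)) ∧
          ∀ n, dist (X n A) (P.Xi A) ≤ (2 : ℝ)⁻¹ ^ n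

/-- The classes `Π_m^G` for problems with values in the non-empty compact subsets of `ℂ`
with the Hausdorff metric. -/
def InPi (P : CompProblem (NonemptyCompacts ℂ) V) : ℕ → Prop
  | 0 => P.InDelta 0
  | m + 1 => P.InDelta (m + 2) ∧
      ∃ Γ : List ℕ → P.Input → NonemptyCompacts ℂ, P.IsTower (m + 1) Γ ∧
        ∃ X : ℕ → P.Input → NonemptyCompacts ℂ, ∀ A,
          (∀ n, (P.Xi A : Set ℂ) ⊆ X n A) ∧
          Tendsto (fun n => Γ [n] A) atTop (𝓝 (P.Xi A)) ∧
          ∀ n, dist (X n A) (Γ [n] A) ≤ (2 : ℝ)⁻¹ ^ n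

section Delta1

variable [MetricSpace V]

/-- The table `a` of values in `V` is `Δ₁`-information about the input `A` of `P`. -/
def IsDelta1Info (P : CompProblem M V) (a : P.Index × ℕ → V) (A : P.Input) : Prop :=
  ∀ i n, dist (a (i, n)) (P.eval i A) ≤ (2 : ℝ)⁻¹ ^ n

theorem xi_eq_of_isDelta1Info (P : CompProblem M V) {a : P.Index × ℕ → V} {A B : P.Input}
    (hA : P.IsDelta1Info a A) (hB : P.IsDelta1Info a B) : P.Xi A = P.Xi B := by
  by_contra h
  obtain ⟨i, hi⟩ := P.separates A B h
  have h0 : Tendsto (fun n : ℕ => (2 : ℝ)⁻¹ ^ n) atTop (𝓝 0) :=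
    tendsto_pow_atTop_nhds_zero_of_lt_one (by norm_num) (by norm_num)
  have key : ∀ C, P.IsDelta1Info a C →
      Tendsto (fun n : ℕ => a (i, n)) atTop (𝓝 (P.eval i C)) := fun C hC =>
    tendsto_iff_dist_tendsto_zero.2 (squeeze_zero (fun _ => dist_nonneg) (hC i) h0)
  exact hi (tendsto_nhds_unique (key A hA) (key B hB))

/-- The computational problem with `Δ₁`-information: the inputs are all tables of approximations,
with error at most `2⁻ⁿ`, of the evaluations of an input `A` of `P`; the value of the problem
function at such a table is `Ξ(A)`, and an algorithm reads entries of the table. -/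
noncomputable def delta1 (P : CompProblem M V) : CompProblem M V where
  Input := {a : P.Index × ℕ → V // ∃ A, P.IsDelta1Info a A}
  Index := P.Index × ℕ
  eval i a := a.1 i
  Xi a := P.Xi a.2.choose
  separates a b h := by
    by_contra! hab
    exact h (congrArg (fun c => P.Xi c.2.choose) (Subtype.ext (funext hab)))

/-- The problem function with `Δ₁`-information does not depend on the choice in `delta1`. -/
theorem delta1_xi (P : CompProblem M V) (a : P.delta1.Input) {A : P.Input}
    (hA : P.IsDelta1Info a.1 A) : P.delta1.Xi a = P.Xi A :=
  P.xi_eq_of_isDelta1Info a.2.choose_spec hA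

end Delta1

end CompProblem

/-! ### Approximate point spectrum and approximate point pseudospectrum -/

section Spectra

variable {E : Type*} [NormedAddCommGroup E] [NormedSpace ℂ E]

/-- The approximate point spectrum. -/
def sigmaAp (T : E →L[ℂ] E) : Set ℂ :=
  {z | ∃ f : ℕ → E, (∀ n, ‖f n‖ = 1) ∧ Tendsto (fun n => ‖T (f n) - z • f n‖) atTop (𝓝 0)}

/-- The approximate point `ε`-pseudospectrum. -/
def sigmaApEps (ε : ℝ) (T : E →L[ℂ] E) : Set ℂ :=
  closure {z | ∃ f : E, ‖f‖ = 1 ∧ ‖T f - z • f‖ < ε}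

theorem mem_sigmaAp_iff (T : E →L[ℂ] E) (z : ℂ) :
    z ∈ sigmaAp T ↔ ∀ δ : ℝ, 0 < δ → ∃ f : E, ‖f‖ = 1 ∧ ‖T f - z • f‖ < δ := by
  constructor
  · rintro ⟨f, hf, hlim⟩ δ hδ
    obtain ⟨n, hn⟩ := (hlim.eventually (gt_mem_nhds hδ)).exists
    exact ⟨f n, hf n, hn⟩
  · intro h
    choose f hf hlt using fun n : ℕ => h (1 / ((n : ℝ) + 1)) (by positivity)
    exact ⟨f, hf, squeeze_zero (fun _ => norm_nonneg _) (fun n => (hlt n).le)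
      tendsto_one_div_add_atTop_nhds_zero_nat⟩

theorem norm_le_of_almost_eigenvector (T : E →L[ℂ] E) {z : ℂ} {f : E} {δ : ℝ} (hf : ‖f‖ = 1)
    (h : ‖T f - z • f‖ < δ) : ‖z‖ ≤ ‖T‖ + δ := by
  have h1 : ‖z • f‖ ≤ ‖T f‖ + ‖T f - z • f‖ := by
    have := norm_sub_le (T f) (T f - z • f)
    rwa [sub_sub_cancel] at this
  rw [norm_smul, hf, mul_one] at h1
  have h2 := T.le_opNorm f
  rw [hf, mul_one] at h2
  linarith

theorem isCompact_sigmaApEps (ε : ℝ) (T : E →L[ℂ] E) : IsCompact (sigmaApEps ε T) := by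
  refine (isCompact_closedBall (0 : ℂ) (‖T‖ + ε)).of_isClosed_subset isClosed_closure
    (closure_minimal ?_ Metric.isClosed_closedBall)
  rintro z ⟨f, hf, h⟩
  simpa using norm_le_of_almost_eigenvector T hf h

theorem isCompact_sigmaAp (T : E →L[ℂ] E) : IsCompact (sigmaAp T) := by
  refine (isCompact_closedBall (0 : ℂ) (‖T‖ + 1)).of_isClosed_subset ?_ ?_
  · refine isClosed_of_closure_subset fun z hz => (mem_sigmaAp_iff T z).2 fun δ hδ => ?_
    obtain ⟨w, hw, hd⟩ := Metric.mem_closure_iff.1 hz (δ / 2) (by positivity)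
    obtain ⟨f, hf, h⟩ := (mem_sigmaAp_iff T w).1 hw (δ / 2) (by positivity)
    refine ⟨f, hf, ?_⟩
    have h1 : T f - z • f = (T f - w • f) + (w - z) • f := by rw [sub_smul]; abel
    have h2 : ‖(w - z) • f‖ < δ / 2 := by
      rw [norm_smul, hf, mul_one, ← dist_eq_norm, dist_comm]; exact hd
    rw [h1]
    linarith [norm_add_le (T f - w • f) ((w - z) • f)]
  · intro z hz
    obtain ⟨f, hf, h⟩ := (mem_sigmaAp_iff T z).1 hz 1 one_pos
    simpa using norm_le_of_almost_eigenvector T hf h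

variable [CompleteSpace E] [Nontrivial E]

/-- A point of the spectrum with maximal real part is an approximate eigenvalue. -/
theorem sigmaAp_nonempty (T : E →L[ℂ] E) : (sigmaAp T).Nonempty := by
  obtain ⟨z, hz, hmax⟩ := (spectrum.isCompact (𝕜 := ℂ) T).exists_isMaxOn (spectrum.nonempty T)
    Complex.continuous_re.continuousOn
  refine ⟨z, ?_⟩
  rw [mem_sigmaAp_iff]
  by_contra! hcon
  obtain ⟨δ, hδ, hbd⟩ := hcon
  have hbd' : ∀ f : E, δ * ‖f‖ ≤ ‖T f - z • f‖ := by
    intro f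
    rcases eq_or_ne f 0 with rfl | hf
    · simp
    have hn : 0 < ‖f‖ := norm_pos_iff.2 hf
    have h1 := hbd (((‖f‖⁻¹ : ℝ) : ℂ) • f) (by
      rw [norm_smul, Complex.norm_real, norm_inv, norm_norm, inv_mul_cancel₀ hn.ne'])
    rw [map_smul, smul_comm z, ← smul_sub, norm_smul, Complex.norm_real, norm_inv,
      norm_norm] at h1
    have h2 := mul_le_mul_of_nonneg_left h1 hn.le
    rw [mul_inv_cancel_left₀ hn.ne'] at h2
    linarith
  set w : ℂ := z + ((δ / 4 : ℝ) : ℂ) with hw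
  have hwz : ‖w - z‖ = δ / 4 := by
    rw [hw, add_sub_cancel_left, Complex.norm_real, Real.norm_of_nonneg (by positivity)]
  have hwn : w ∉ spectrum ℂ T := by
    intro hmem
    have h1 : w.re ≤ z.re := hmax hmem
    rw [hw, Complex.add_re, Complex.ofReal_re] at h1
    linarith
  rw [spectrum.notMem_iff] at hwn
  obtain ⟨u, hu⟩ := hwn
  have hlow : ∀ f : E, 3 * δ / 4 * ‖f‖ ≤ ‖(u : E →L[ℂ] E) f‖ := by
    intro f
    have h1 : (u : E →L[ℂ] E) f = (w - z) • f - (T f - z • f) := by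
      rw [hu]
      simp only [sub_apply, Algebra.algebraMap_eq_smul_one,
        smul_apply, one_apply_eq_self, sub_smul]
      abel
    have h2 : ‖T f - z • f‖ ≤ ‖(w - z) • f‖ + ‖(u : E →L[ℂ] E) f‖ := by
      have h3 : T f - z • f = (w - z) • f - (u : E →L[ℂ] E) f := by rw [h1]; abel
      rw [h3]
      exact norm_sub_le _ _
    rw [norm_smul, hwz] at h2
    linarith [hbd' f]
  have hinv : ‖((u⁻¹ : (E →L[ℂ] E)ˣ) : E →L[ℂ] E)‖ ≤ (3 * δ / 4)⁻¹ := by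
    refine ContinuousLinearMap.opNorm_le_bound _ (by positivity) fun f => ?_
    have h1 := hlow (((u⁻¹ : (E →L[ℂ] E)ˣ) : E →L[ℂ] E) f)
    have h2 : (u : E →L[ℂ] E) (((u⁻¹ : (E →L[ℂ] E)ˣ) : E →L[ℂ] E) f) = f := by
      rw [← mul_apply_eq_comp, u.mul_inv, one_apply_eq_self]
    rw [h2] at h1
    rw [inv_mul_eq_div, le_div_iff₀ (by positivity)]
    linarith
  have hpos : 0 < ‖((u⁻¹ : (E →L[ℂ] E)ˣ) : E →L[ℂ] E)‖ := Units.norm_pos _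
  have hunit : IsUnit (algebraMap ℂ (E →L[ℂ] E) z - T) := by
    refine ⟨Units.ofNearby u (algebraMap ℂ (E →L[ℂ] E) z - T) ?_, rfl⟩
    have h1 : algebraMap ℂ (E →L[ℂ] E) z - T - u = algebraMap ℂ (E →L[ℂ] E) (z - w) := by
      rw [hu, map_sub]; abel
    rw [h1, norm_algebraMap', norm_sub_rev, hwz]
    calc δ / 4 < 3 * δ / 4 := by linarith
      _ ≤ _ := by
        rw [le_inv_comm₀ (by positivity) hpos]
        exact hinv
  exact (spectrum.notMem_iff.2 hunit) hz

theorem sigmaApEps_nonempty {ε : ℝ} (hε : 0 < ε) (T : E →L[ℂ] E) :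
    (sigmaApEps ε T).Nonempty := by
  obtain ⟨z, hz⟩ := sigmaAp_nonempty T
  exact ⟨z, subset_closure ((mem_sigmaAp_iff T z).1 hz ε hε)⟩

/-- The approximate point spectrum as a non-empty compact subset of `ℂ`. -/
def sigmaApCompact (T : E →L[ℂ] E) : NonemptyCompacts ℂ :=
  ⟨⟨sigmaAp T, isCompact_sigmaAp T⟩, sigmaAp_nonempty T⟩

/-- The approximate point `ε`-pseudospectrum as a non-empty compact subset of `ℂ`. -/
def sigmaApEpsCompact (ε : ℝ) (hε : 0 < ε) (T : E →L[ℂ] E) : NonemptyCompacts ℂ :=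
  ⟨⟨sigmaApEps ε T, isCompact_sigmaApEps ε T⟩, sigmaApEps_nonempty hε T⟩

end Spectra

/-! ### Koopman operators on `L^p` -/

section Koopman

variable {X : Type*} [MetricSpace X] [MeasurableSpace X] [BorelSpace X]

/-- The class `Ω_X` of continuous, nonsingular maps with bounded Koopman operator on `L^p`. -/
def generalClass (p : ℝ≥0∞) (ω : Measure X) : Set C(X, X) :=
  {F | Measure.map F ω ≪ ω ∧
    ∃ C : ℝ≥0, ∀ f : X → ℂ, MemLp f p ω → eLpNorm (f ∘ F) p ω ≤ C * eLpNorm f p ω}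

/-- The class `Ω_X^m` of continuous, measure-preserving maps. -/
def measurePreservingClass (ω : Measure X) : Set C(X, X) :=
  {F | Measure.map F ω = ω}

theorem measurePreservingClass_subset (p : ℝ≥0∞) (ω : Measure X) :
    measurePreservingClass ω ⊆ generalClass p ω := by
  intro F hF
  have hmp : MeasurePreserving F ω ω := ⟨F.continuous.measurable, hF⟩
  refine ⟨hmp.quasiMeasurePreserving.absolutelyContinuous, 1, fun f hf => ?_⟩
  rw [eLpNorm_comp_measurePreserving hf.1 hmp]
  simp

variable {p : ℝ≥0∞} {ω : Measure X}

theorem quasiMeasurePreserving_of_mem {F : C(X, X)} (hF : F ∈ generalClass p ω) :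
    Measure.QuasiMeasurePreserving F ω ω :=
  ⟨F.continuous.measurable, hF.1⟩

theorem memLp_comp_of_mem {F : C(X, X)} (hF : F ∈ generalClass p ω) {f : X → ℂ}
    (hf : MemLp f p ω) : MemLp (f ∘ F) p ω := by
  obtain ⟨C, hC⟩ := hF.2
  exact ⟨hf.1.comp_quasiMeasurePreserving (quasiMeasurePreserving_of_mem hF),
    (hC f hf).trans_lt (ENNReal.mul_lt_top ENNReal.coe_lt_top hf.2)⟩

variable [Fact (1 ≤ p)]

/-- The Koopman operator `f ↦ f ∘ F` on `L^p(X, ω)`. -/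
noncomputable def koopman (F : C(X, X)) (hF : F ∈ generalClass p ω) :
    Lp ℂ p ω →L[ℂ] Lp ℂ p ω :=
  LinearMap.mkContinuousOfExistsBound
    { toFun := fun f => (memLp_comp_of_mem hF (Lp.memLp f)).toLp (f ∘ F)
      map_add' := fun f g => by
        rw [← MemLp.toLp_add]
        exact MemLp.toLp_congr _ _
          ((quasiMeasurePreserving_of_mem hF).ae_eq_comp (Lp.coeFn_add f g))
      map_smul' := fun c f => by
        rw [RingHom.id_apply, ← MemLp.toLp_const_smul]
        exact MemLp.toLp_congr _ _
          ((quasiMeasurePreserving_of_mem hF).ae_eq_comp (Lp.coeFn_smul c f)) }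
    (by
      obtain ⟨C, hC⟩ := hF.2
      refine ⟨C, fun f => ?_⟩
      simp only [LinearMap.coe_mk, AddHom.coe_mk]
      rw [Lp.norm_toLp, Lp.norm_def, ← ENNReal.coe_toReal C, ← ENNReal.toReal_mul]
      exact ENNReal.toReal_mono
        (ENNReal.mul_lt_top ENNReal.coe_lt_top (Lp.memLp f).2).ne (hC f (Lp.memLp f)))

theorem koopman_coeFn (F : C(X, X)) (hF : F ∈ generalClass p ω) (f : Lp ℂ p ω) :
    koopman F hF f =ᵐ[ω] f ∘ F :=
  (memLp_comp_of_mem hF (Lp.memLp f)).coeFn_toLp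

instance nontrivial_Lp_of_neZero [IsFiniteMeasure ω] [NeZero ω] : Nontrivial (Lp ℂ p ω) := by
  refine ⟨⟨Lp.const p ω (1 : ℂ), 0, fun h => ?_⟩⟩
  have h1 : (fun _ : X => (1 : ℂ)) =ᵐ[ω] 0 := by
    refine (Lp.coeFn_const (p := p) (μ := ω) (1 : ℂ)).symm.trans ?_
    rw [h]
    exact Lp.coeFn_zero ℂ p ω
  have : (ae ω).NeBot := inferInstance
  obtain ⟨x, hx⟩ := h1.exists
  exact one_ne_zero hx

/-- The problem of computing `spec (K_F)` from the point evaluations `F ↦ F x`, `x ∈ X`, where `F`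
ranges over the class `S` and `K_F` is the Koopman operator of `F` on `L^p(X, ω)`. -/
noncomputable def koopmanProblem (spec : (Lp ℂ p ω →L[ℂ] Lp ℂ p ω) → NonemptyCompacts ℂ)
    (S : Set C(X, X)) (hS : S ⊆ generalClass p ω) : CompProblem (NonemptyCompacts ℂ) X where
  Input := S
  Index := X
  eval x F := F.1 x
  Xi F := spec (koopman F.1 (hS F.2))
  separates F G h := by
    by_contra! hFG
    obtain rfl : F = G := Subtype.ext (ContinuousMap.ext hFG)
    exact h rfl

variable (p ω) [IsFiniteMeasure ω] [NeZero ω]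

/-- `{Ξ_{σ_ap,ε}, Ω_X, M_H, Λ}^{Δ₁}` -/
noncomputable def apEpsGeneral (ε : ℝ) (hε : 0 < ε) : CompProblem (NonemptyCompacts ℂ) X :=
  (koopmanProblem (sigmaApEpsCompact ε hε) (generalClass p ω) subset_rfl).delta1

/-- `{Ξ_{σ_ap,ε}, Ω_X^m, M_H, Λ}^{Δ₁}` -/
noncomputable def apEpsMeasurePreserving (ε : ℝ) (hε : 0 < ε) :
    CompProblem (NonemptyCompacts ℂ) X :=
  (koopmanProblem (sigmaApEpsCompact ε hε) (measurePreservingClass ω)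
    (measurePreservingClass_subset p ω)).delta1

/-- `{Ξ_{σ_ap}, Ω_X, M_H, Λ}^{Δ₁}` -/
noncomputable def apGeneral : CompProblem (NonemptyCompacts ℂ) X :=
  (koopmanProblem (p := p) (ω := ω) sigmaApCompact (generalClass p ω) subset_rfl).delta1

/-- `{Ξ_{σ_ap}, Ω_X^m, M_H, Λ}^{Δ₁}` -/
noncomputable def apMeasurePreserving : CompProblem (NonemptyCompacts ℂ) X :=
  (koopmanProblem (p := p) (ω := ω) sigmaApCompact (measurePreservingClass ω)
    (measurePreservingClass_subset p ω)).delta1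

end Koopman

/-!
The number `1` is an eigenvalue of every Koopman operator, so it may be added to all finite sets of
accepted points, which keeps them non-empty. The pseudospectrum is the closure of the points `z`
with `‖K f - z f‖ < ε ‖f‖`, where `(z, f)` runs through a countable dense family with continuous
`f`. The integral behind the norm is the limit of integrals of simple functions that are read off
from finitely many entries of the table, so the strict inequality has the form `∃ l, ∀ k, …`; this
costs two limits. Since `σ_ap` is the intersection of the pseudospectra, one more limit suffices
for it.

For the lower bounds, the Cantor set is cut, up to a null set, into countably many clopen cells,
over which skew products by a circle rotation and a translation of a Boolean group can be prescribed
independently. Left alone, a cell rotates so that `i` is an eigenvalue; once given a datum, it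
carries an involution, which differs from the rotation by an arbitrarily small amount at any finite
set of points. If all cells have data, the operator is an isometric involution and its
pseudospectrum stays away from a point that the eigenvalue `i` would force into it. By the Baire
category theorem on the space of sequences of data, one sequence defeats all base algorithms of a
tower at once.
-/

/-! ### Monotone limits of compact sets -/

section HausdorffLimits

variable {α ι : Type*} [TopologicalSpace α]

theorem tendsto_nonemptyCompacts_iff {l : Filter ι} {K : ι → NonemptyCompacts α}
    {K₀ : NonemptyCompacts α} :
    Tendsto K l (𝓝 K₀) ↔
      (∀ U, IsOpen U → (K₀ : Set α) ⊆ U → ∀ᶠ i in l, (K i : Set α) ⊆ U) ∧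
        ∀ U, IsOpen U → ((K₀ : Set α) ∩ U).Nonempty → ∀ᶠ i in l, ((K i : Set α) ∩ U).Nonempty := by
  let _ := TopologicalSpace.vietoris α
  rw [NonemptyCompacts.isEmbedding_coe.tendsto_nhds_iff, tendsto_nhds_generateFrom_iff]
  simp only [Set.mem_union, or_imp, forall_and, Set.forall_mem_image]
  rfl

variable [Preorder ι]

theorem tendsto_of_antitone_of_eq_iInter [T2Space α] [IsDirectedOrder ι] [Nonempty ι]
    {K : ι → NonemptyCompacts α} {K₀ : NonemptyCompacts α} (hK : Antitone K)
    (h : (K₀ : Set α) = ⋂ i, (K i : Set α)) : Tendsto K atTop (𝓝 K₀) := by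
  refine tendsto_nonemptyCompacts_iff.2 ⟨fun U hU hKU => ?_, fun U _ hKU => ?_⟩
  · obtain ⟨i, hi⟩ := exists_subset_nhds_of_isCompact' (V := fun i => (K i : Set α))
      (Antitone.directed_ge hK) (fun i => (K i).isCompact) (fun i => (K i).isCompact.isClosed)
      fun x hx => hU.mem_nhds (hKU (h ▸ hx))
    filter_upwards [eventually_ge_atTop i] with j hj using Set.Subset.trans (hK hj) hi
  · exact Eventually.of_forall fun i =>
      hKU.mono (Set.inter_subset_inter_left U (h ▸ Set.iInter_subset _ i))

theorem tendsto_of_monotone_of_subset_closure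
    {K : ι → NonemptyCompacts α} {K₀ : NonemptyCompacts α} (hK : Monotone K) (hle : ∀ i, K i ≤ K₀)
    (h : (K₀ : Set α) ⊆ closure (⋃ i, (K i : Set α))) : Tendsto K atTop (𝓝 K₀) := by
  refine tendsto_nonemptyCompacts_iff.2
    ⟨fun U _ hKU => Eventually.of_forall fun i => Set.Subset.trans (hle i) hKU,
      fun U hU hKU => ?_⟩
  obtain ⟨x, hxK, hxU⟩ := hKU
  obtain ⟨y, hyU, hy⟩ := mem_closure_iff.1 (h hxK) U hU hxU
  obtain ⟨i, hi⟩ := Set.mem_iUnion.1 hy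
  filter_upwards [eventually_ge_atTop i] with j hj using ⟨y, hK hj hi, hyU⟩

end HausdorffLimits

/-! ### Towers of finite sets -/

section FiniteStages

variable {α : Type*} [TopologicalSpace α]

/-- The compact set `{z₀} ∪ {ζ j | j < m, s j}`: the base point `z₀` together with the candidates
among the first `m` terms of `ζ` that are accepted by `s`. -/
def acceptedPoints (z₀ : α) (ζ : ℕ → α) (m : ℕ) (s : ℕ → Prop) : NonemptyCompacts α :=
  ⟨⟨insert z₀ (ζ '' {j | j < m ∧ s j}),
    ((((Set.finite_lt_nat m).subset fun _ h => h.1).image ζ).insert z₀).isCompact⟩,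
    Set.insert_nonempty _ _⟩

theorem acceptedPoints_congr {z₀ : α} {ζ : ℕ → α} {m : ℕ} {s t : ℕ → Prop}
    (h : ∀ j < m, (s j ↔ t j)) : acceptedPoints z₀ ζ m s = acceptedPoints z₀ ζ m t := by
  refine NonemptyCompacts.ext (congrArg (fun J => insert z₀ (ζ '' J)) ?_)
  exact Set.ext fun j => and_congr_right (h j)

theorem eventually_forall_le_iff (c : ℕ → Prop) : ∀ᶠ n in atTop, (∀ k ≤ n, c k) ↔ ∀ k, c k := by
  by_cases hc : ∀ k, c k
  · exact Eventually.of_forall fun n => iff_of_true (fun k _ => hc k) hc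
  · obtain ⟨k, hk⟩ := not_forall.1 hc
    filter_upwards [eventually_ge_atTop k] with n hn
    exact iff_of_false (fun h => hk (h k hn)) hc

theorem tendsto_acceptedPoints_forall_le (z₀ : α) (ζ : ℕ → α) (m : ℕ) (c : ℕ → ℕ → Prop) :
    Tendsto (fun n => acceptedPoints z₀ ζ m fun j => ∀ k ≤ n, c j k) atTop
      (𝓝 (acceptedPoints z₀ ζ m fun j => ∀ k, c j k)) := by
  refine tendsto_const_nhds.congr' ?_
  filter_upwards [(Set.finite_lt_nat m).eventually_all.2 fun j _ => eventually_forall_le_iff (c j)]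
    with n hn
  exact acceptedPoints_congr fun j hj => (hn j hj).symm

theorem acceptedPoints_le {z₀ : α} {ζ : ℕ → α} {s : ℕ → Prop} {K : NonemptyCompacts α}
    (hz₀ : z₀ ∈ K) (hK : (K : Set α) = closure (ζ '' {j | s j})) (m : ℕ) :
    acceptedPoints z₀ ζ m s ≤ K :=
  Set.insert_subset hz₀ (((Set.image_mono fun _ h => h.2).trans subset_closure).trans_eq hK.symm)

theorem tendsto_acceptedPoints {z₀ : α} {ζ : ℕ → α} {s : ℕ → Prop} {K : NonemptyCompacts α}
    (hz₀ : z₀ ∈ K) (hK : (K : Set α) = closure (ζ '' {j | s j})) :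
    Tendsto (fun m => acceptedPoints z₀ ζ m s) atTop (𝓝 K) := by
  refine tendsto_of_monotone_of_subset_closure (fun m n hmn => ?_) (acceptedPoints_le hz₀ hK)
    (hK.trans_subset (closure_mono ?_))
  · exact Set.insert_subset_insert (Set.image_mono fun j h => ⟨h.1.trans_le hmn, h.2⟩)
  · rintro - ⟨j, hj, rfl⟩
    exact Set.mem_iUnion.2 ⟨j + 1, Or.inr ⟨j, ⟨j.lt_succ_self, hj⟩, rfl⟩⟩

end FiniteStages

theorem lt_iff_exists_forall_ge_le_sub {u : ℕ → ℝ} {a : ℝ} (hu : Tendsto u atTop (𝓝 a))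
    (b : ℝ) : a < b ↔ ∃ l : ℕ, ∀ k ≥ l, u k ≤ b - 1 / ((l : ℝ) + 1) := by
  constructor
  · intro hab
    obtain ⟨l₀, hl₀⟩ := exists_nat_one_div_lt (sub_pos.2 hab)
    obtain ⟨N, hN⟩ := eventually_atTop.1
      (hu.eventually (gt_mem_nhds (lt_sub_comm.1 hl₀)))
    refine ⟨max l₀ N, fun k hk => (hN k (le_of_max_le_right hk)).le.trans ?_⟩
    exact sub_le_sub_left (Nat.one_div_le_one_div (le_max_left l₀ N)) b
  · rintro ⟨l, hl⟩
    refine (le_of_tendsto hu (eventually_atTop.2 ⟨l, hl⟩)).trans_lt (sub_lt_self b ?_)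
    positivity

namespace CompProblem

variable {M V β γ ι : Type*}

/-- The map `g` depends only on finitely many evaluations, the same for all inputs. -/
def FinitelyDetermined (P : CompProblem M V) (g : P.Input → β) : Prop :=
  ∃ Q : Finset P.Index, ∀ A B, (∀ i ∈ Q, P.eval i A = P.eval i B) → g A = g B

namespace FinitelyDetermined

variable {P : CompProblem M V}

theorem isGeneralAlgorithm [Nonempty P.Index] {Γ : P.Input → M}
    (h : P.FinitelyDetermined Γ) : P.IsGeneralAlgorithm Γ := by
  classical
  obtain ⟨Q, hQ⟩ := h
  obtain ⟨i₀⟩ := ‹Nonempty P.Index›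
  exact ⟨fun _ => insert i₀ Q, fun A => ⟨Finset.insert_nonempty _ _, fun B hB =>
    ⟨rfl, hQ A B fun i hi => hB i (Finset.mem_insert_of_mem hi)⟩⟩⟩

theorem comp {g : P.Input → β} (h : P.FinitelyDetermined g) (φ : β → γ) :
    P.FinitelyDetermined fun A => φ (g A) :=
  h.imp fun _ hQ A B hAB => congrArg φ (hQ A B hAB)

theorem of_family {g : P.Input → β} {s : Set ι} (hs : s.Finite) {c : ι → P.Input → γ}
    (hc : ∀ i ∈ s, P.FinitelyDetermined (c i))
    (hg : ∀ A B, (∀ i ∈ s, c i A = c i B) → g A = g B) : P.FinitelyDetermined g := by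
  classical
  choose! Q hQ using hc
  exact ⟨hs.toFinset.biUnion Q, fun A B h => hg A B fun i hi =>
    hQ i hi A B fun k hk => h k (Finset.mem_biUnion.2 ⟨i, hs.mem_toFinset.2 hi, hk⟩)⟩

end FinitelyDetermined

/-- `T` and `L` form the two lower levels of a tower of height two computing `ξ`, whose intermediate
values `L m A = lim_n T m n A` lie inside `ξ A`. -/
structure IsInnerTower (P : CompProblem (NonemptyCompacts ℂ) V)
    (ξ : P.Input → NonemptyCompacts ℂ) (T : ℕ → ℕ → P.Input → NonemptyCompacts ℂ)
    (L : ℕ → P.Input → NonemptyCompacts ℂ) : Prop where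
  isGeneralAlgorithm : ∀ m n, P.IsGeneralAlgorithm (T m n)
  tendsto_inner : ∀ m A, Tendsto (fun n => T m n A) atTop (𝓝 (L m A))
  tendsto_outer : ∀ A, Tendsto (fun m => L m A) atTop (𝓝 (ξ A))
  le : ∀ m A, L m A ≤ ξ A

theorem exists_isInnerTower (P : CompProblem (NonemptyCompacts ℂ) V) [Nonempty P.Index]
    {ξ : P.Input → NonemptyCompacts ℂ} {z₀ : ℂ} (hz₀ : ∀ A, z₀ ∈ ξ A) {ζ : ℕ → ℂ}
    {c : ℕ → ℕ → P.Input → Prop} (hc : ∀ j k, P.FinitelyDetermined (c j k))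
    (hξ : ∀ A, (ξ A : Set ℂ) = closure (ζ '' {j | ∀ k, c j k A})) :
    ∃ T L, P.IsInnerTower ξ T L := by
  refine ⟨fun m n A => acceptedPoints z₀ ζ m fun j => ∀ k ≤ n, c j k A,
    fun m A => acceptedPoints z₀ ζ m fun j => ∀ k, c j k A, fun m n => ?_,
    fun m A => tendsto_acceptedPoints_forall_le z₀ ζ m fun j k => c j k A,
    fun A => tendsto_acceptedPoints (hz₀ A) (hξ A), fun m A => acceptedPoints_le (hz₀ A) (hξ A) m⟩
  refine (FinitelyDetermined.of_family ((Set.finite_lt_nat m).prod (Set.finite_le_nat n))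
    (fun i _ => hc i.1 i.2) fun A B h => ?_).isGeneralAlgorithm
  exact acceptedPoints_congr fun j hj => forall₂_congr fun k hk => (h (j, k) ⟨hj, hk⟩).to_iff

theorem exists_isInnerTower_of_tendsto (P : CompProblem (NonemptyCompacts ℂ) V) [Nonempty P.Index]
    {ξ : P.Input → NonemptyCompacts ℂ} {z₀ : ℂ} (hz₀ : ∀ A, z₀ ∈ ξ A) {ζ : ℕ → ℂ} {b : ℕ → ℝ}
    {u : ℕ → ℕ → P.Input → ℝ} {a : ℕ → P.Input → ℝ} (hu : ∀ i k, P.FinitelyDetermined (u i k))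
    (hua : ∀ i A, Tendsto (fun k => u i k A) atTop (𝓝 (a i A)))
    (hξ : ∀ A, (ξ A : Set ℂ) = closure (ζ '' {i | a i A < b i})) :
    ∃ T L, P.IsInnerTower ξ T L := by
  refine P.exists_isInnerTower hz₀ (ζ := fun j => ζ j.unpair.1)
    (c := fun j k A => k ≥ j.unpair.2 → u j.unpair.1 k A ≤ b j.unpair.1 - 1 / (j.unpair.2 + 1))
    (fun j k => (hu j.unpair.1 k).comp
      fun t => k ≥ j.unpair.2 → t ≤ b j.unpair.1 - 1 / (j.unpair.2 + 1)) fun A => ?_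
  rw [hξ]
  congr 1
  ext z
  constructor
  · rintro ⟨i, hi, rfl⟩
    obtain ⟨l, hl⟩ := (lt_iff_exists_forall_ge_le_sub (hua i A) _).1 hi
    exact ⟨Nat.pair i l, by simpa only [Set.mem_ofPred_eq, Nat.unpair_pair] using hl, by simp⟩
  · rintro ⟨j, hj, rfl⟩
    exact ⟨j.unpair.1, (lt_iff_exists_forall_ge_le_sub (hua j.unpair.1 A) _).2 ⟨_, hj⟩, rfl⟩

theorem IsInnerTower.inSigma {P : CompProblem (NonemptyCompacts ℂ) V} {T L}
    (h : P.IsInnerTower P.Xi T L) : P.InSigma 2 := by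
  let Γ : List ℕ → P.Input → NonemptyCompacts ℂ
    | [] => P.Xi
    | [m] => L m
    | m :: n :: _ => T m n
  have hΓ : P.IsTower 2 Γ := by
    refine ⟨fun l hl => ?_, fun l hl A => ?_, fun A => rfl⟩
    · match l, hl with
      | [m, n], _ => exact h.isGeneralAlgorithm m n
    · match l, hl with
      | [], _ => exact h.tendsto_outer A
      | [m], _ => exact h.tendsto_inner m A
  exact ⟨⟨2, le_rfl, Γ, hΓ⟩, Γ, hΓ, fun _ => P.Xi, fun A => ⟨fun m => h.le m A, h.tendsto_outer A,
    fun n => (dist_self (P.Xi A)).trans_le (by positivity)⟩⟩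

theorem inPi_three_of_isInnerTower {P : CompProblem (NonemptyCompacts ℂ) V}
    {ξ : ℕ → P.Input → NonemptyCompacts ℂ} {T : ℕ → ℕ → ℕ → P.Input → NonemptyCompacts ℂ}
    {L : ℕ → ℕ → P.Input → NonemptyCompacts ℂ} (h : ∀ s, P.IsInnerTower (ξ s) (T s) (L s))
    (hle : ∀ s A, P.Xi A ≤ ξ s A)
    (hlim : ∀ A, Tendsto (fun s => ξ s A) atTop (𝓝 (P.Xi A))) : P.InPi 3 := by
  let Γ : List ℕ → P.Input → NonemptyCompacts ℂ
    | [] => P.Xi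
    | [s] => ξ s
    | [s, m] => L s m
    | s :: m :: n :: _ => T s m n
  have hΓ : P.IsTower 3 Γ := by
    refine ⟨fun l hl => ?_, fun l hl A => ?_, fun A => rfl⟩
    · match l, hl with
      | [s, m, n], _ => exact (h s).isGeneralAlgorithm m n
    · match l, hl with
      | [], _ => exact hlim A
      | [s], _ => exact (h s).tendsto_outer A
      | [s, m], _ => exact (h s).tendsto_inner m A
  exact ⟨⟨3, le_rfl, Γ, hΓ⟩, Γ, hΓ, ξ, fun A => ⟨fun s => hle s A, hlim A,
    fun s => (dist_self (ξ s A)).trans_le (by positivity)⟩⟩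

end CompProblem

/-! ### Spectral sets of bounded operators -/

section SpectralSets

variable {E : Type*} [NormedAddCommGroup E] [NormedSpace ℂ E]

theorem sigmaAp_subset_sigmaApEps {ε : ℝ} (hε : 0 < ε) (T : E →L[ℂ] E) :
    sigmaAp T ⊆ sigmaApEps ε T := fun z hz =>
  subset_closure ((mem_sigmaAp_iff T z).1 hz ε hε)

theorem sigmaApEps_mono (T : E →L[ℂ] E) : Monotone fun ε => sigmaApEps ε T :=
  fun _ _ h => closure_mono fun _ ⟨f, hf, hlt⟩ => ⟨f, hf, hlt.trans_le h⟩

theorem exists_norm_lt_of_mem_sigmaApEps {ε δ : ℝ} (h : ε < δ) {T : E →L[ℂ] E} {z : ℂ}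
    (hz : z ∈ sigmaApEps ε T) : ∃ f : E, ‖f‖ = 1 ∧ ‖T f - z • f‖ < δ := by
  obtain ⟨w, ⟨f, hf, hlt⟩, hd⟩ := Metric.mem_closure_iff.1 hz (δ - ε) (sub_pos.2 h)
  refine ⟨f, hf, ?_⟩
  calc ‖T f - z • f‖ = ‖(T f - w • f) - (z - w) • f‖ := by rw [sub_smul, sub_sub_sub_cancel_right]
    _ ≤ ‖T f - w • f‖ + ‖(z - w) • f‖ := norm_sub_le _ _
    _ = ‖T f - w • f‖ + dist z w := by rw [norm_smul, hf, mul_one, dist_eq_norm]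
    _ < ε + (δ - ε) := add_lt_add hlt hd
    _ = δ := add_sub_cancel ε δ

theorem sigmaAp_eq_iInter (T : E →L[ℂ] E) :
    sigmaAp T = ⋂ n : ℕ, sigmaApEps (1 / ((n : ℝ) + 1)) T := by
  refine subset_antisymm (Set.subset_iInter fun n =>
    sigmaAp_subset_sigmaApEps Nat.one_div_pos_of_nat T) fun z hz => ?_
  refine (mem_sigmaAp_iff T z).2 fun δ hδ => ?_
  obtain ⟨n, hn⟩ := exists_nat_one_div_lt hδ
  exact exists_norm_lt_of_mem_sigmaApEps hn (Set.mem_iInter.1 hz n)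

theorem exists_norm_eq_one_and_norm_sub_smul_lt_iff {T : E →L[ℂ] E} {z : ℂ} {ε : ℝ} :
    (∃ f, ‖f‖ = 1 ∧ ‖T f - z • f‖ < ε) ↔ ∃ f, ‖T f - z • f‖ < ε * ‖f‖ := by
  refine ⟨fun ⟨f, hf, h⟩ => ⟨f, by rwa [hf, mul_one]⟩, fun ⟨f, h⟩ => ?_⟩
  have hf : f ≠ 0 := by
    rintro rfl
    simp at h
  refine ⟨((‖f‖⁻¹ : ℝ) : ℂ) • f, by simpa using norm_smul_inv_norm (𝕜 := ℂ) hf, ?_⟩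
  rwa [map_smul, smul_comm z, ← smul_sub, norm_smul, Complex.norm_real, norm_inv, norm_norm,
    inv_mul_lt_iff₀ (norm_pos_iff.2 hf), mul_comm]

theorem sigmaApEps_eq_closure_image (ε : ℝ) (T : E →L[ℂ] E) {ι : Type*} {z : ι → ℂ} {f : ι → E}
    (hd : DenseRange fun i => (z i, f i)) :
    sigmaApEps ε T = closure (z '' {i | ‖T (f i) - z i • f i‖ < ε * ‖f i‖}) := by
  simp only [sigmaApEps, exists_norm_eq_one_and_norm_sub_smul_lt_iff]
  refine subset_antisymm (closure_minimal ?_ isClosed_closure) (closure_mono ?_)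
  · rintro w ⟨g, hg⟩
    refine mem_closure_iff.2 fun U hU hw => ?_
    have hopen : IsOpen {w : ℂ × E | w.1 ∈ U ∧ ‖T w.2 - w.1 • w.2‖ < ε * ‖w.2‖} := by
      refine (hU.preimage continuous_fst).and (isOpen_lt ?_ ?_) <;> fun_prop
    obtain ⟨i, hi⟩ := hd.exists_mem_open hopen ⟨(w, g), hw, hg⟩
    exact ⟨z i, hi.1, i, hi.2, rfl⟩
  · rintro - ⟨i, hi, rfl⟩
    exact ⟨f i, hi⟩

section Eigenvalues

variable {T : E →L[ℂ] E} {z : ℂ}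

theorem closedBall_subset_sigmaApEps (hz : Module.End.HasEigenvalue (T : E →ₗ[ℂ] E) z) {ε : ℝ}
    (hε : 0 < ε) : Metric.closedBall z ε ⊆ sigmaApEps ε T := by
  obtain ⟨f, hf⟩ := hz.exists_hasEigenvector
  have hTf : T f = z • f := hf.apply_eq_smul
  rw [← closure_ball z hε.ne']
  refine closure_mono fun w hw => exists_norm_eq_one_and_norm_sub_smul_lt_iff.2 ⟨f, ?_⟩
  rw [hTf, ← sub_smul, norm_smul, ← dist_eq_norm, dist_comm]
  exact mul_lt_mul_of_pos_right hw (norm_pos_iff.2 hf.2)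

theorem mem_sigmaAp_of_hasEigenvalue (hz : Module.End.HasEigenvalue (T : E →ₗ[ℂ] E) z) :
    z ∈ sigmaAp T := by
  rw [sigmaAp_eq_iInter]
  exact Set.mem_iInter.2 fun n => closedBall_subset_sigmaApEps hz Nat.one_div_pos_of_nat
    (Metric.mem_closedBall_self Nat.one_div_pos_of_nat.le)

end Eigenvalues

section Involutions

variable {T : E →L[ℂ] E}

theorem norm_one_sub_sq_le_of_involutive (hT : Function.Involutive T) (hn : ∀ f, ‖T f‖ ≤ ‖f‖)
    (z : ℂ) {f : E} (hf : ‖f‖ = 1) : ‖1 - z ^ 2‖ ≤ (1 + ‖z‖) * ‖T f - z • f‖ := by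
  have hfac : (1 - z ^ 2) • f = T (T f - z • f) + z • (T f - z • f) := by
    rw [map_sub, map_smul, hT, sub_smul, one_smul, smul_sub, smul_smul, sq]
    abel
  calc ‖1 - z ^ 2‖ = ‖(1 - z ^ 2) • f‖ := by rw [norm_smul, hf, mul_one]
    _ ≤ ‖T (T f - z • f)‖ + ‖z • (T f - z • f)‖ := hfac ▸ norm_add_le _ _
    _ ≤ ‖T f - z • f‖ + ‖z‖ * ‖T f - z • f‖ := add_le_add (hn _) (norm_smul _ _).le
    _ = (1 + ‖z‖) * ‖T f - z • f‖ := by ring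

/-- A closed set that contains the `ε`-pseudospectrum of every contractive involution. It comes from
`1 - z ^ 2 = (T + z) (T - z)` for `T ^ 2 = 1`. -/
def involutionBound (ε : ℝ) : Set ℂ :=
  {z | ‖1 - z ^ 2‖ ≤ (1 + ‖z‖) * ε}

theorem isClosed_involutionBound (ε : ℝ) : IsClosed (involutionBound ε) :=
  isClosed_le (by fun_prop) (by fun_prop)

theorem sigmaApEps_subset_involutionBound (hT : Function.Involutive T) (hn : ∀ f, ‖T f‖ ≤ ‖f‖)
    (ε : ℝ) : sigmaApEps ε T ⊆ involutionBound ε := by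
  refine closure_minimal ?_ (isClosed_involutionBound ε)
  rintro z ⟨f, hf, hlt⟩
  exact (norm_one_sub_sq_le_of_involutive hT hn z hf).trans
    (mul_le_mul_of_nonneg_left hlt.le (by positivity))

theorem mul_I_notMem_involutionBound {t ε : ℝ} (ht : 0 ≤ t) (h : (1 + t) * ε < 1 + t ^ 2) :
    (t : ℂ) * Complex.I ∉ involutionBound ε := by
  have hsq : 1 - ((t : ℂ) * Complex.I) ^ 2 = ((1 + t ^ 2 : ℝ) : ℂ) := by
    rw [mul_pow, Complex.I_sq]
    push_cast
    ring
  rw [involutionBound, Set.mem_ofPred_eq, hsq, norm_mul, Complex.norm_I, mul_one, Complex.norm_real,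
    Complex.norm_real, Real.norm_of_nonneg ht, Real.norm_of_nonneg (by positivity), not_le]
  exact h

end Involutions

end SpectralSets

section KoopmanOperators

variable {X : Type*} [MetricSpace X] [MeasurableSpace X] [BorelSpace X] {p : ℝ≥0∞} {ω : Measure X}
  [Fact (1 ≤ p)] {F : C(X, X)}

theorem norm_koopman (hF : F ∈ generalClass p ω) (hF' : F ∈ measurePreservingClass ω)
    (f : Lp ℂ p ω) : ‖koopman F hF f‖ = ‖f‖ := by
  have hmp : MeasurePreserving F ω ω := ⟨F.continuous.measurable, hF'⟩
  rw [Lp.norm_def, Lp.norm_def, eLpNorm_congr_ae (koopman_coeFn F hF f),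
    eLpNorm_comp_measurePreserving (Lp.memLp f).1 hmp]

theorem involutive_koopman (hF : F ∈ generalClass p ω) (hinv : Function.Involutive F) :
    Function.Involutive (koopman F hF) := fun f => by
  refine Lp.ext ?_
  filter_upwards [koopman_coeFn F hF (koopman F hF f),
    (quasiMeasurePreserving_of_mem hF).ae_eq_comp (koopman_coeFn F hF f)] with x h₁ h₂
  rw [h₁, h₂, Function.comp_apply, Function.comp_apply, hinv]

theorem hasEigenvalue_koopman (hF : F ∈ generalClass p ω) {u : X → ℂ} (hu : MemLp u p ω)
    (hne : ¬u =ᵐ[ω] 0) {z : ℂ} (huF : u ∘ F =ᵐ[ω] z • u) :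
    Module.End.HasEigenvalue (koopman F hF : Lp ℂ p ω →ₗ[ℂ] Lp ℂ p ω) z := by
  refine Module.End.hasEigenvalue_of_hasEigenvector (x := hu.toLp u)
    ⟨Module.End.mem_eigenspace_iff.2 (Lp.ext ?_),
      fun h => hne (hu.coeFn_toLp.symm.trans (h ▸ Lp.coeFn_zero ℂ p ω))⟩
  exact (koopman_coeFn F hF (hu.toLp u)).trans <|
    ((quasiMeasurePreserving_of_mem hF).ae_eq_comp hu.coeFn_toLp).trans <| huF.trans <|
      (hu.coeFn_toLp.const_smul z).symm.trans (Lp.coeFn_smul z _).symm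

theorem hasEigenvalue_koopman_one [IsFiniteMeasure ω] [NeZero ω] (hF : F ∈ generalClass p ω) :
    Module.End.HasEigenvalue (koopman F hF : Lp ℂ p ω →ₗ[ℂ] Lp ℂ p ω) 1 := by
  refine hasEigenvalue_koopman hF (memLp_const 1) (fun h => ?_) (.of_forall fun x => by simp)
  obtain ⟨_, hx⟩ := (h : ∀ᵐ _ ∂ω, (1 : ℂ) = 0).exists
  exact one_ne_zero hx

end KoopmanOperators

/-! ### Upper bounds -/

theorem CompProblem.IsDelta1Info.tendstoUniformly {M V : Type*} [MetricSpace V]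
    {P : CompProblem M V} {a : P.Index × ℕ → V} {A : P.Input} (h : P.IsDelta1Info a A) :
    TendstoUniformly (fun n i => a (i, n)) (fun i => P.eval i A) atTop := by
  refine Metric.tendstoUniformly_iff.2 fun δ hδ => ?_
  filter_upwards [(tendsto_pow_atTop_nhds_zero_of_lt_one (r := (2 : ℝ)⁻¹) (by norm_num)
    (by norm_num)).eventually_lt_const hδ] with n hn i
  rw [dist_comm]
  exact (h i n).trans_lt hn

section SampledIntegrals

variable {X : Type*} [MeasurableSpace X]

/-- The integral of `‖f ∘ G - z • f‖ ^ r`, sampled at the finitely many values of `s`. -/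
noncomputable def sampledIntegral (ω : Measure X) (r : ℝ) (f : X → ℂ) (z : ℂ) (s : SimpleFunc X X)
    (G : X → X) : ℝ :=
  ∫ x, ‖f (G (s x)) - z * f (s x)‖ ^ r ∂ω

theorem sampledIntegral_congr {ω : Measure X} {r : ℝ} {f : X → ℂ} {z : ℂ} {s : SimpleFunc X X}
    {G H : X → X} (h : ∀ y ∈ s.range, G y = H y) :
    sampledIntegral ω r f z s G = sampledIntegral ω r f z s H := by
  simp only [sampledIntegral, h _ (SimpleFunc.mem_range_self s _)]

variable [UniformSpace X] [CompactSpace X]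

theorem tendsto_sampledIntegral (ω : Measure X) [IsFiniteMeasure ω] {r : ℝ} (hr : 0 ≤ r)
    (f : C(X, ℂ)) (z : ℂ) {s : ℕ → SimpleFunc X X} (hs : ∀ x, Tendsto (fun n => s n x) atTop (𝓝 x))
    {G : ℕ → X → X} {F : X → X} (hF : Continuous F) (hG : TendstoUniformly G F atTop) :
    Tendsto (fun n => sampledIntegral ω r f z (s n) (G n)) atTop
      (𝓝 (∫ x, ‖f (F x) - z * f x‖ ^ r ∂ω)) := by
  refine tendsto_integral_of_dominated_convergence (fun _ => (‖f‖ + ‖z‖ * ‖f‖) ^ r) (fun n => ?_)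
    (integrable_const _) (fun n => .of_forall fun x => ?_) (.of_forall fun x => ?_)
  · exact ((s n).map fun y => ‖f (G n y) - z * f y‖ ^ r).aestronglyMeasurable
  · rw [Real.norm_of_nonneg (by positivity)]
    refine Real.rpow_le_rpow (norm_nonneg _) ((norm_sub_le _ _).trans ?_) hr
    rw [norm_mul]
    gcongr <;> exact f.norm_coe_le_norm _
  · have hFx : Tendsto (fun n => G n (s n x)) atTop (𝓝 (F x)) :=
      hG.tendsto_comp hF.continuousAt (hs x)
    exact (((f.continuous.tendsto _).comp hFx).sub
      (((f.continuous.tendsto _).comp (hs x)).const_mul z)).norm.rpow_const (.inr hr)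

end SampledIntegrals

section UpperBounds

variable {X : Type*} [MetricSpace X] [MeasurableSpace X] [BorelSpace X] [CompactSpace X]
  {p : ℝ≥0∞} [Fact (1 ≤ p)] {ω : Measure X} [IsFiniteMeasure ω]

theorem norm_koopman_sub_smul_rpow (hp : p ≠ ∞) {F : C(X, X)} (hF : F ∈ generalClass p ω)
    (f : C(X, ℂ)) (z : ℂ) :
    ‖koopman F hF (ContinuousMap.toLp p ω ℂ f) - z • ContinuousMap.toLp p ω ℂ f‖ ^ p.toReal =
      ∫ x, ‖f (F x) - z * f x‖ ^ p.toReal ∂ω := by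
  have hp₀ : p ≠ 0 := (one_pos.trans_le Fact.out).ne'
  set g := koopman F hF (ContinuousMap.toLp p ω ℂ f) - z • ContinuousMap.toLp p ω ℂ f with hg
  have hgx : ∀ᵐ x ∂ω, g x = f (F x) - z * f x := by
    have hf := ContinuousMap.coeFn_toLp (p := p) (𝕜 := ℂ) ω f
    filter_upwards [hf, (quasiMeasurePreserving_of_mem hF).ae_eq_comp hf,
      koopman_coeFn F hF (ContinuousMap.toLp p ω ℂ f),
      Lp.coeFn_sub (koopman F hF (ContinuousMap.toLp p ω ℂ f)) (z • ContinuousMap.toLp p ω ℂ f),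
      Lp.coeFn_smul z (ContinuousMap.toLp p ω ℂ f)] with x hf hfF hK hsub hsmul
    rw [hg, hsub, Pi.sub_apply, hsmul, Pi.smul_apply, hK, hfF, hf, smul_eq_mul,
      Function.comp_apply]
  have hint : 0 ≤ ∫ x, ‖g x‖ ^ p.toReal ∂ω := integral_nonneg fun x => by positivity
  rw [Lp.norm_def, (Lp.memLp g).eLpNorm_eq_integral_rpow_norm hp₀ hp,
    ENNReal.toReal_ofReal (by positivity), ← Real.rpow_mul hint,
    inv_mul_cancel₀ (ENNReal.toReal_pos hp₀ hp).ne', Real.rpow_one]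
  exact integral_congr_ae (hgx.mono fun x hx => congrArg (‖·‖ ^ p.toReal) hx)

theorem sigmaApEps_koopman_eq_closure (hp : p ≠ ∞) {ε : ℝ} (hε : 0 ≤ ε) {F : C(X, X)}
    (hF : F ∈ generalClass p ω) {ι : Type*} {z : ι → ℂ} {f : ι → C(X, ℂ)}
    (hd : DenseRange fun i => (z i, f i)) :
    sigmaApEps ε (koopman F hF) = closure (z '' {i | ∫ x, ‖f i (F x) - z i * f i x‖ ^ p.toReal ∂ω <
      (ε * ‖ContinuousMap.toLp p ω ℂ (f i)‖) ^ p.toReal}) := by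
  have hp₀ : 0 < p.toReal := ENNReal.toReal_pos (one_pos.trans_le Fact.out).ne' hp
  have hdLp : DenseRange fun i => (z i, ContinuousMap.toLp p ω ℂ (f i)) :=
    (denseRange_id.prodMap (ContinuousMap.toLp_denseRange ℂ ω ℂ hp)).comp hd
      (continuous_id.prodMap (ContinuousMap.toLp p ω ℂ).continuous)
  simp only [sigmaApEps_eq_closure_image ε _ hdLp, ← norm_koopman_sub_smul_rpow hp hF,
    Real.rpow_lt_rpow_iff (norm_nonneg _) (mul_nonneg hε (norm_nonneg _)) hp₀]

variable [NeZero ω] {spec : (Lp ℂ p ω →L[ℂ] Lp ℂ p ω) → NonemptyCompacts ℂ} {S : Set C(X, X)}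
  {hS : S ⊆ generalClass p ω}

/-- The Koopman operator of a map that is approximated by the table `A`. -/
noncomputable def tableOperator (A : (koopmanProblem spec S hS).delta1.Input) :
    Lp ℂ p ω →L[ℂ] Lp ℂ p ω :=
  koopman A.2.choose.1 (hS A.2.choose.2)

theorem exists_isInnerTower_sigmaApEps (hp : p ≠ ∞) {ε : ℝ} (hε : 0 < ε)
    (spec : (Lp ℂ p ω →L[ℂ] Lp ℂ p ω) → NonemptyCompacts ℂ) (hS : S ⊆ generalClass p ω) :
    ∃ T L, (koopmanProblem spec S hS).delta1.IsInnerTower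
      (fun A => sigmaApEpsCompact ε hε (tableOperator A)) T L := by
  have : Nonempty X := not_isEmpty_iff.1 fun _ => NeZero.ne ω ω.eq_zero_of_isEmpty
  have : Nonempty (koopmanProblem spec S hS).delta1.Index := inferInstanceAs (Nonempty (X × ℕ))
  obtain ⟨s, hs⟩ : StronglyMeasurable (id : X → X) := stronglyMeasurable_id
  let q := denseSeq (ℂ × C(X, ℂ))
  refine CompProblem.exists_isInnerTower_of_tendsto _ (z₀ := 1) (fun A => ?_)
    (ζ := fun i => (q i).1) (b := fun i => (ε * ‖ContinuousMap.toLp p ω ℂ (q i).2‖) ^ p.toReal)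
    (u := fun i k A =>
      sampledIntegral ω p.toReal (q i).2 (q i).1 (s k) fun x => A.1 ((x, k) : X × ℕ))
    (fun i k => ?_)
    (fun i A => tendsto_sampledIntegral ω ENNReal.toReal_nonneg _ _ hs A.2.choose.1.continuous
      A.2.choose_spec.tendstoUniformly)
    fun A => sigmaApEps_koopman_eq_closure hp hε.le _ (denseRange_denseSeq _)
  · exact closedBall_subset_sigmaApEps (hasEigenvalue_koopman_one _) hε
      (Metric.mem_closedBall_self hε.le)
  · exact ⟨(s k).range ×ˢ {k}, fun A B h => sampledIntegral_congr fun y hy =>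
      h (y, k) (Finset.mk_mem_product hy (Finset.mem_singleton_self k))⟩

theorem koopmanProblem_sigmaApEps_inSigma_two (hp : p ≠ ∞) {ε : ℝ} (hε : 0 < ε)
    (hS : S ⊆ generalClass p ω) :
    (koopmanProblem (sigmaApEpsCompact ε hε) S hS).delta1.InSigma 2 := by
  obtain ⟨T, L, h⟩ := exists_isInnerTower_sigmaApEps hp hε (sigmaApEpsCompact ε hε) hS
  exact CompProblem.IsInnerTower.inSigma h

theorem koopmanProblem_sigmaAp_inPi_three (hp : p ≠ ∞) (hS : S ⊆ generalClass p ω) :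
    (koopmanProblem sigmaApCompact S hS).delta1.InPi 3 := by
  choose T L h using fun n : ℕ =>
    exists_isInnerTower_sigmaApEps hp (Nat.one_div_pos_of_nat (n := n)) sigmaApCompact hS
  exact CompProblem.inPi_three_of_isInnerTower h
    (fun n A => sigmaAp_subset_sigmaApEps Nat.one_div_pos_of_nat _)
    fun A => tendsto_of_antitone_of_eq_iInter
      (fun m n hmn => sigmaApEps_mono _ (Nat.one_div_le_one_div hmn)) (sigmaAp_eq_iInter _)

end UpperBounds

/-! ### Adversarial families of inputs -/

namespace CompProblem

variable {M V : Type*}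

theorem InDelta.exists_tendsto [MetricSpace M] {P : CompProblem M V} (h : P.InDelta 2) :
    ∃ Γ : ℕ → P.Input → M, (∀ k, P.IsGeneralAlgorithm (Γ k)) ∧
      ∀ A, Tendsto (fun k => Γ k A) atTop (𝓝 (P.Xi A)) := by
  obtain ⟨j, hj, Γ, hΓ⟩ := h
  obtain rfl | rfl : j = 0 ∨ j = 1 := Nat.le_one_iff_eq_zero_or_eq_one.1 hj
  · refine ⟨fun _ => P.Xi, fun _ => ?_, fun _ => tendsto_const_nhds⟩
    exact funext hΓ.top ▸ hΓ.base [] rfl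
  · exact ⟨fun k => Γ [k], fun k => hΓ.base [k] rfl, fun A => hΓ.top A ▸ hΓ.lim [] one_pos A⟩

variable [MetricSpace V]

theorem IsGeneralAlgorithm.exists_entries {P : CompProblem M V} {Γ : P.delta1.Input → M}
    (h : P.delta1.IsGeneralAlgorithm Γ) (A : P.delta1.Input) :
    ∃ Q : Finset (P.Index × ℕ), ∀ B : P.delta1.Input, (∀ x ∈ Q, A.1 x = B.1 x) → Γ A = Γ B := by
  obtain ⟨Q, hQ⟩ := h
  exact ⟨Q A, fun B hB => ((hQ A).2 B hB).2⟩

/-- A family of inputs of `P` with parameters in `ℕ → Option I`, each evaluation of which depends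
on one coordinate of the parameter. The value is in `𝒜` if some coordinate is `none` and in `ℬ` if
there is no such coordinate; any coordinate `none` can be changed so that finitely many evaluations
vary arbitrarily little. -/
structure AdversarialFamily (P : CompProblem M V) (I : Type*) (𝒜 ℬ : Set M) where
  /-- the family -/
  input : (ℕ → Option I) → P.Input
  /-- the coordinate on which an evaluation depends -/
  coord : P.Index → ℕ
  eval_congr : ∀ i s t, s (coord i) = t (coord i) → P.eval i (input s) = P.eval i (input t)
  xi_mem_of_none : ∀ s m, s m = none → P.Xi (input s) ∈ 𝒜
  xi_mem_of_some : ∀ s : ℕ → I, P.Xi (input fun m => some (s m)) ∈ ℬ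
  exists_approx : ∀ s m, s m = none → ∀ (E : Finset P.Index) (η : ℝ), 0 < η →
    ∃ i, ∀ x ∈ E,
      dist (P.eval x (input s)) (P.eval x (input (Function.update s m (some i)))) ≤ η

namespace AdversarialFamily

variable {P : CompProblem M V} {I : Type*} {𝒜 ℬ : Set M} (φ : P.AdversarialFamily I 𝒜 ℬ)

section Tables

variable (s : ℕ → Option I) (e : ℕ → P.Index × ℕ → V)

open Classical in
/-- The table of the input `φ.input s` whose entries at evaluations depending on the coordinate `m`
are prescribed by `e m`, as far as they are admissible. -/
noncomputable def table (x : P.Index × ℕ) : V :=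
  if dist (e (φ.coord x.1) x) (P.eval x.1 (φ.input s)) ≤ (2 : ℝ)⁻¹ ^ x.2
  then e (φ.coord x.1) x else P.eval x.1 (φ.input s)

theorem isDelta1Info_table : P.IsDelta1Info (φ.table s e) (φ.input s) := fun i n => by
  rw [table]
  split_ifs with h
  · exact h
  · rw [dist_self]; positivity

/-- `φ.table s e` as an input of the problem with `Δ₁`-information. -/
noncomputable def tableInput : P.delta1.Input :=
  ⟨φ.table s e, φ.input s, φ.isDelta1Info_table s e⟩

theorem xi_tableInput : P.delta1.Xi (φ.tableInput s e) = P.Xi (φ.input s) :=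
  P.delta1_xi _ (φ.isDelta1Info_table s e)

variable {s e}

theorem table_congr {s' : ℕ → Option I} {e' : ℕ → P.Index × ℕ → V} {x : P.Index × ℕ}
    (hs : s (φ.coord x.1) = s' (φ.coord x.1)) (he : e (φ.coord x.1) = e' (φ.coord x.1)) :
    φ.table s e x = φ.table s' e' x := by
  rw [table, table, he, φ.eval_congr x.1 s s' hs]

theorem exists_table_update_eq {m : ℕ} (hs : s m = none)
    (he : e m = fun x => P.eval x.1 (φ.input s)) (Q : Finset (P.Index × ℕ)) :
    ∃ i, ∀ x ∈ Q, φ.table s e x = φ.table (Function.update s m (some i)) e x := by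
  classical
  obtain ⟨i, hi⟩ := φ.exists_approx s m hs (Q.image Prod.fst) ((2 : ℝ)⁻¹ ^ Q.sup Prod.snd)
    (by positivity)
  refine ⟨i, fun x hx => ?_⟩
  rcases eq_or_ne (φ.coord x.1) m with rfl | hxm
  · have hle : dist (P.eval x.1 (φ.input s))
        (P.eval x.1 (φ.input (Function.update s (φ.coord x.1) (some i)))) ≤ (2 : ℝ)⁻¹ ^ x.2 :=
      (hi x.1 (Finset.mem_image_of_mem _ hx)).trans
        (pow_le_pow_of_le_one (by norm_num) (by norm_num) (Finset.le_sup (f := Prod.snd) hx))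
    simp only [table, he, if_pos hle, ite_self]
  · exact φ.table_congr (Function.update_of_ne hxm _ _).symm rfl

end Tables

/-- A value for one coordinate of the parameter of an adversarial family, together with the table
entries proposed for the evaluations that depend on this coordinate. -/
structure Move (P : CompProblem M V) (I : Type*) where
  /-- the value of the coordinate -/
  datum : I
  /-- the proposed entries -/
  entries : P.Index × ℕ → V

instance : TopologicalSpace (Move P I) := ⊥

instance : DiscreteTopology (Move P I) := ⟨rfl⟩

/-- The input of the problem with `Δ₁`-information described by a sequence of moves. -/
noncomputable def play (w : ℕ → Move P I) : P.delta1.Input :=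
  φ.tableInput (fun m => some (w m).datum) fun m => (w m).entries

theorem play_congr {w w' : ℕ → Move P I} {x : P.Index × ℕ}
    (h : w (φ.coord x.1) = w' (φ.coord x.1)) : (φ.play w).1 x = (φ.play w').1 x :=
  φ.table_congr (s := fun m => some (w m).datum) (s' := fun m => some (w' m).datum)
    (e := fun m => (w m).entries) (e' := fun m => (w' m).entries) (by rw [h]) (by rw [h])

theorem xi_play_mem (w : ℕ → Move P I) : P.delta1.Xi (φ.play w) ∈ ℬ := by
  rw [play, xi_tableInput]
  exact φ.xi_mem_of_some _

theorem isOpen_setOf_play_mem {Γ : P.delta1.Input → M} (hΓ : P.delta1.IsGeneralAlgorithm Γ)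
    (S : Set M) : IsOpen {w | Γ (φ.play w) ∈ S} := by
  refine isOpen_iff_mem_nhds.2 fun w hw => ?_
  obtain ⟨Q, hQ⟩ := hΓ.exists_entries (φ.play w)
  have hnear : ∀ᶠ w' in 𝓝 w, ∀ x ∈ Q, w' (φ.coord x.1) = w (φ.coord x.1) :=
    (Finset.eventually_all Q).2 fun x _ =>
      ((continuous_apply (A := fun _ : ℕ => Move P I) (φ.coord x.1)).tendsto w).eventually
        ((isOpen_discrete {w (φ.coord x.1)}).mem_nhds rfl)
  filter_upwards [hnear] with w' hw'
  have hplay : Γ (φ.play w) = Γ (φ.play w') := hQ _ fun x hx => φ.play_congr (hw' x hx).symm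
  exact hplay ▸ hw

theorem exists_play_update_mem {ι : Type*} {Γ : ι → P.delta1.Input → M}
    (hΓ : ∀ k, P.delta1.IsGeneralAlgorithm (Γ k)) {S : Set M}
    (hS : ∀ A, P.delta1.Xi A ∈ 𝒜 → ∃ k, Γ k A ∈ S) (w : ℕ → Move P I) (m : ℕ) :
    ∃ j k, Γ k (φ.play (Function.update w m j)) ∈ S := by
  let s : ℕ → Option I := Function.update (fun n => some (w n).datum) m none
  let e := Function.update (fun n => (w n).entries) m fun x => P.eval x.1 (φ.input s)
  have hs : s m = none := Function.update_self _ _ _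
  obtain ⟨k, hk⟩ := hS (φ.tableInput s e) (φ.xi_tableInput s e ▸ φ.xi_mem_of_none s m hs)
  obtain ⟨Q, hQ⟩ := (hΓ k).exists_entries (φ.tableInput s e)
  obtain ⟨i, hi⟩ := φ.exists_table_update_eq (e := e) hs (Function.update_self ..) Q
  let j : Move P I := ⟨i, fun x => P.eval x.1 (φ.input s)⟩
  have hplay : φ.play (Function.update w m j) = φ.tableInput (Function.update s m (some i)) e := by
    rw [play]
    congr 1 <;> funext n <;> rcases eq_or_ne n m with rfl | hn <;> simp [s, e, j, *]
  exact ⟨j, k, by rwa [hplay, ← hQ (φ.tableInput _ e) hi]⟩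

theorem dense_setOf_exists_play_mem {ι : Type*} {Γ : ι → P.delta1.Input → M}
    (hΓ : ∀ k, P.delta1.IsGeneralAlgorithm (Γ k)) {S : Set M}
    (hS : ∀ A, P.delta1.Xi A ∈ 𝒜 → ∃ k, Γ k A ∈ S) : Dense {w | ∃ k, Γ k (φ.play w) ∈ S} := by
  intro w
  choose j hj using φ.exists_play_update_mem hΓ hS w
  refine mem_closure_of_tendsto (f := fun m => Function.update w m (j m)) (b := atTop)
    (tendsto_pi_nhds.2 fun n => tendsto_const_nhds.congr' ?_) (Eventually.of_forall hj)
  filter_upwards [eventually_gt_atTop n] with m hm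
  rw [Function.update_of_ne hm.ne]

theorem eventually_residual_frequently_play_mem {Γ : ℕ → P.delta1.Input → M}
    (hΓ : ∀ k, P.delta1.IsGeneralAlgorithm (Γ k)) {S : Set M}
    (hS : ∀ A, P.delta1.Xi A ∈ 𝒜 → ∃ᶠ k in atTop, Γ k A ∈ S) :
    ∀ᶠ w in residual (ℕ → Move P I), ∃ᶠ k in atTop, Γ k (φ.play w) ∈ S := by
  simp only [frequently_atTop] at hS ⊢
  refine eventually_countable_forall.2 fun l => residual_of_dense_open ?_ ?_
  · simp only [Set.ofPred_exists]
    exact isOpen_iUnion fun k => isOpen_const.and (φ.isOpen_setOf_play_mem (hΓ k) S)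
  · have hdense : Dense {w | ∃ k : Set.Ici l, Γ k (φ.play w) ∈ S} :=
      φ.dense_setOf_exists_play_mem (Γ := fun k : Set.Ici l => Γ k) (fun k => hΓ k) fun A hA =>
        (hS A hA l).elim fun k hk => ⟨⟨k, hk.1⟩, hk.2⟩
    refine hdense.mono ?_
    rintro w ⟨k, hk⟩
    exact ⟨k, k.2, hk⟩

theorem exists_of_eventually_residual (φ : P.AdversarialFamily I 𝒜 ℬ) {p : (ℕ → Move P I) → Prop}
    (h : ∀ᶠ w in residual (ℕ → Move P I), p w) : ∃ w, p w := by
  obtain ⟨i, -⟩ := φ.exists_approx (fun _ => none) 0 rfl ∅ 1 one_pos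
  have : Nonempty (Move P I) := ⟨⟨i, fun x => P.eval x.1 (φ.input fun _ => none)⟩⟩
  exact (dense_of_mem_residual h).nonempty

end AdversarialFamily

theorem not_inDelta_two_of_adversarialFamily [MetricSpace M] {P : CompProblem M V} {I : Type*}
    {𝒜 ℬ : Set M} (φ : P.AdversarialFamily I 𝒜 ℬ) (h : SeparatedNhds 𝒜 ℬ) :
    ¬ P.delta1.InDelta 2 := by
  intro hP
  obtain ⟨Γ, hΓ, hlim⟩ := hP.exists_tendsto
  obtain ⟨U, W, hU, hW, hAU, hBW, hUW⟩ := h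
  obtain ⟨w, hw⟩ := φ.exists_of_eventually_residual <|
    φ.eventually_residual_frequently_play_mem hΓ fun A hA =>
      ((hlim A).eventually (hU.mem_nhds (hAU hA))).frequently
  obtain ⟨k, hkU, hkW⟩ := (hw.and_eventually
    ((hlim (φ.play w)).eventually (hW.mem_nhds (hBW (φ.xi_play_mem w))))).exists
  exact Set.disjoint_left.1 hUW hkU hkW

theorem exists_le_infDist {z₀ : ℂ} {N : Set ℂ} (hN : IsClosed N) (hz₀ : z₀ ∉ N) :
    ∃ δ > 0, ∀ K : NonemptyCompacts ℂ, (K : Set ℂ) ⊆ N → δ ≤ Metric.infDist z₀ (K : Set ℂ) := by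
  obtain ⟨δ, hδ, hb⟩ := Metric.isOpen_iff.1 hN.isOpen_compl z₀ hz₀
  refine ⟨δ, hδ, fun K hK => (Metric.le_infDist K.nonempty).2 fun w hw => ?_⟩
  by_contra! h
  exact hb (Metric.mem_ball'.2 h) (hK hw)

theorem separatedNhds_mem_subset {z₀ : ℂ} {N : Set ℂ} (hN : IsClosed N) (hz₀ : z₀ ∉ N) :
    SeparatedNhds {K : NonemptyCompacts ℂ | z₀ ∈ K} {K | (K : Set ℂ) ⊆ N} := by
  obtain ⟨δ, hδ, hfar⟩ := exists_le_infDist hN hz₀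
  have hcont := (Metric.lipschitz_infDist_set z₀).continuous
  refine ⟨_, _, isOpen_Iio.preimage hcont, isOpen_Ioi.preimage hcont, fun K hK => ?_,
    fun K hK => ?_, (Set.Iio_disjoint_Ioi_same (a := δ / 2)).preimage _⟩
  · exact (Metric.infDist_zero_of_mem (s := (K : Set ℂ)) hK).trans_lt (half_pos hδ)
  · exact (half_lt_self hδ).trans_le (hfar K hK)

theorem not_inPi_two_of_adversarialFamily {P : CompProblem (NonemptyCompacts ℂ) V} {I : Type*}
    {z₀ : ℂ} {N : Set ℂ} (hN : IsClosed N) (hz₀ : z₀ ∉ N)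
    (φ : P.AdversarialFamily I {K | z₀ ∈ K} {K | (K : Set ℂ) ⊆ N}) : ¬ P.delta1.InPi 2 := by
  rintro ⟨-, Γ, hΓ, X, hX⟩
  obtain ⟨δ, hδ, hfar⟩ := exists_le_infDist hN hz₀
  let g (K : NonemptyCompacts ℂ) : ℝ := Metric.infDist z₀ (K : Set ℂ)
  have hg : Continuous g := (Metric.lipschitz_infDist_set z₀).continuous
  have hlim (n A) : Tendsto (fun k => g (Γ [n, k] A)) atTop (𝓝 (g (Γ [n] A))) :=
    (hg.tendsto _).comp (hΓ.lim [n] one_lt_two A)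
  have hnear (n A) (hA : z₀ ∈ P.delta1.Xi A) : g (Γ [n] A) ≤ (2 : ℝ)⁻¹ ^ n := by
    have hle := (Metric.lipschitz_infDist_set z₀).dist_le_mul (Γ [n] A) (X n A)
    rw [Metric.infDist_zero_of_mem ((hX A).1 n hA), Real.dist_0_eq_abs, NNReal.coe_one, one_mul,
      dist_comm] at hle
    exact (le_abs_self _).trans (hle.trans ((hX A).2.2 n))
  obtain ⟨n₀, hn₀⟩ : ∃ n₀, ∀ n ≥ n₀, (2 : ℝ)⁻¹ ^ n < δ / 2 :=
    eventually_atTop.1 ((tendsto_pow_atTop_nhds_zero_of_lt_one (by norm_num)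
      (by norm_num)).eventually_lt_const (half_pos hδ))
  obtain ⟨w, hw⟩ := φ.exists_of_eventually_residual <| eventually_countable_forall.2 fun n =>
    φ.eventually_residual_frequently_play_mem (Γ := fun k => Γ [n₀ + n, k])
      (S := {K | g K ≤ δ / 2}) (fun k => hΓ.base [n₀ + n, k] rfl) fun A hA =>
      ((hlim (n₀ + n) A).eventually_le_const
        ((hnear _ A hA).trans_lt (hn₀ _ (Nat.le_add_right _ _)))).frequently
  have hle (n) : g (Γ [n₀ + n] (φ.play w)) ≤ δ / 2 := by
    by_contra! hlt
    obtain ⟨k, hk, hk'⟩ :=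
      ((hw n).and_eventually ((hlim _ (φ.play w)).eventually_const_lt hlt)).exists
    exact hk.not_gt hk'
  have hXi : g (P.delta1.Xi (φ.play w)) ≤ δ / 2 :=
    le_of_tendsto ((hg.tendsto _).comp (hX (φ.play w)).2.1) <|
      (eventually_ge_atTop n₀).mono fun n hn => Nat.add_sub_of_le hn ▸ hle (n - n₀)
  exact ((half_lt_self hδ).trans_le (hfar _ (φ.xi_play_mem w))).not_ge hXi

end CompProblem

/-! ### Skew products over the Cantor set -/

namespace CantorSkew

/-- The Cantor space that is cut into the cells on which a skew product is prescribed. -/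
abbrev Base : Type := ℕ → Bool

/-- The Boolean group acted on by the fibre translations; the coordinates `(m, l)` belong to the
`m`-th cell. -/
abbrev Fibre : Type := ℕ × ℕ → Bool

/-- The product of the circle and the Cantor set, on which the skew products act. -/
abbrev Phase : Type := AddCircle (1 : ℝ) × cantorSet

/-- The prescription for one cell: the index of the fibre coordinate to be flipped, and the clopen
set that tells in which direction to rotate. -/
abbrev Datum : Type := ℕ × Clopens Fibre

/-- The points of the base whose first coordinate `true` is the `m`-th one. -/
def cell (m : ℕ) : Set Base := {y | IsLeast {i | y i = true} m}

theorem isClopen_cell (m : ℕ) : IsClopen (cell m) := by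
  have h : cell m = (fun y => y m) ⁻¹' {true} ∩
      ⋂ i ∈ Finset.range m, (fun y => y i) ⁻¹' {false} := by
    ext y
    simp only [cell, IsLeast, mem_lowerBounds, Set.mem_ofPred_eq, Set.mem_inter_iff,
      Set.mem_preimage, Set.mem_singleton_iff, Set.mem_iInter, Finset.mem_range]
    exact and_congr_right fun _ => forall_congr' fun i => by
      rw [← not_imp_not, not_le, Bool.not_eq_true]
  rw [h]
  exact ((isClopen_discrete _).preimage (continuous_apply m)).inter
    (isClopen_biInter_finset fun i _ => (isClopen_discrete _).preimage (continuous_apply i))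

theorem cell_nonempty (m : ℕ) : (cell m).Nonempty :=
  ⟨fun i => decide (i = m), by simp, fun i hi => by simp_all⟩

theorem fibre_add_self (v : Fibre) : v + v = 0 :=
  funext fun q => BooleanRing.add_self (v q)

/-- The translation of the fibres over the `m`-th cell. -/
def flip (m : ℕ) : Option Datum → Fibre
  | none => 0
  | some d => Pi.single (m, d.1) true

/-- The direction of the rotation over the `m`-th cell. Given a datum, it is antisymmetric under the
flip, which makes the skew product an involution. -/
noncomputable def direction (m : ℕ) : Option Datum → Fibre → ℝ
  | none => 1
  | some d => fun w =>
      (d.2 : Set Fibre).indicator 1 w - (d.2 : Set Fibre).indicator 1 (w + flip m (some d))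

theorem direction_add_flip (m : ℕ) (d : Datum) (w : Fibre) :
    direction m (some d) (w + flip m (some d)) = -direction m (some d) w := by
  simp only [direction]
  rw [add_assoc, fibre_add_self, add_zero, neg_sub]

theorem continuous_direction (m : ℕ) (o : Option Datum) : Continuous (direction m o) := by
  cases o with
  | none => exact continuous_const
  | some d =>
    have h := d.2.isClopen.continuous_indicator (continuous_one (M := ℝ))
    exact h.sub (h.comp (continuous_add_const _))

theorem abs_direction_le (m : ℕ) (o : Option Datum) (w : Fibre) : |direction m o w| ≤ 1 := by
  cases o with
  | none => simp [direction]
  | some d =>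
    simp only [direction, Set.indicator]
    split_ifs <;> simp

/-- The translation of the fibre over `y`. -/
noncomputable def shift (s : ℕ → Option Datum) (y : Base) : Fibre :=
  fun q => (cell q.1).indicator (fun _ => flip q.1 (s q.1) q) y

theorem shift_of_mem (s : ℕ → Option Datum) {y : Base} {m : ℕ} (hy : y ∈ cell m) :
    shift s y = flip m (s m) := by
  funext q
  by_cases hq : q.1 = m
  · rw [shift, hq, Set.indicator_of_mem hy]
  · rw [shift, Set.indicator_of_notMem fun h => hq (h.unique hy)]
    cases s m with
    | none => rfl
    | some d =>
      have hne : q ≠ (m, d.1) := fun h => hq (congrArg Prod.fst h)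
      exact (Pi.single_eq_of_ne (M := fun _ => Bool) hne true).symm

theorem shift_congr {s t : ℕ → Option Datum} {y : Base} (h : ∀ m, y ∈ cell m → s m = t m) :
    shift s y = shift t y :=
  funext fun q => by
    by_cases hq : y ∈ cell q.1
    · rw [shift, shift, h _ hq]
    · rw [shift, shift, Set.indicator_of_notMem hq, Set.indicator_of_notMem hq]

theorem continuous_shift (s : ℕ → Option Datum) : Continuous (shift s) :=
  continuous_pi fun q => (isClopen_cell q.1).continuous_indicator continuous_const

/-- The angle of the rotation over the point `v`. -/
noncomputable def angle (s : ℕ → Option Datum) (v : Base × Fibre) : ℝ :=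
  ∑' m : ℕ, (cell m).indicator 1 v.1 * ((1 / 4 : ℝ) ^ (m + 1) * direction m (s m) v.2)

theorem angle_of_mem (s : ℕ → Option Datum) {v : Base × Fibre} {m : ℕ} (hv : v.1 ∈ cell m) :
    angle s v = (1 / 4 : ℝ) ^ (m + 1) * direction m (s m) v.2 := by
  rw [angle, tsum_eq_single m fun n hn => ?_, Set.indicator_of_mem hv, Pi.one_apply, one_mul]
  rw [Set.indicator_of_notMem fun h => hn (h.unique hv), zero_mul]

theorem angle_congr {s t : ℕ → Option Datum} {v : Base × Fibre}
    (h : ∀ m, v.1 ∈ cell m → s m = t m) : angle s v = angle t v := by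
  refine tsum_congr fun m => ?_
  by_cases hm : v.1 ∈ cell m
  · rw [h m hm]
  · rw [Set.indicator_of_notMem hm, zero_mul, zero_mul]

theorem continuous_angle (s : ℕ → Option Datum) : Continuous (angle s) := by
  refine continuous_tsum (u := fun m : ℕ => (1 / 4 : ℝ) ^ (m + 1)) (fun m => ?_)
    ((summable_nat_add_iff 1).2 (summable_geometric_of_lt_one (by norm_num) (by norm_num)))
    fun m v => ?_
  · exact (((isClopen_cell m).continuous_indicator continuous_one).comp continuous_fst).mul
      (continuous_const.mul ((continuous_direction m (s m)).comp continuous_snd))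
  · have h : ‖(cell m).indicator (1 : Base → ℝ) v.1‖ ≤ 1 :=
      (norm_indicator_le_norm_self _ _).trans (by simp)
    calc _ ≤ 1 * ((1 / 4 : ℝ) ^ (m + 1) * 1) := by
          rw [norm_mul, norm_mul, Real.norm_of_nonneg (by positivity : 0 ≤ (1 / 4 : ℝ) ^ (m + 1))]
          gcongr
          exact abs_direction_le m (s m) v.2
      _ = _ := by rw [one_mul, mul_one]

theorem angle_add_shift (s : ℕ → Datum) (y : Base) (w : Fibre) :
    angle (fun m => some (s m)) (y, w + shift (fun m => some (s m)) y) =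
      -angle (fun m => some (s m)) (y, w) := by
  rw [angle, angle, ← tsum_neg]
  refine tsum_congr fun m => ?_
  by_cases hm : y ∈ cell m
  · rw [shift_of_mem _ hm, direction_add_flip, mul_neg, mul_neg]
  · rw [Set.indicator_of_notMem hm, zero_mul, zero_mul, neg_zero]

/-- The Cantor set as the product of the base and the fibre. -/
noncomputable def homeo : cantorSet ≃ₜ Base × Fibre :=
  cantorSetHomeomorphNatToBool.trans
    ((Homeomorph.piCongrLeft (Y := fun _ : ℕ ⊕ ℕ × ℕ => Bool)
      (Denumerable.equiv₂ ℕ (ℕ ⊕ ℕ × ℕ))).trans Homeomorph.sumArrowHomeomorphProdArrow)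

/-- The skew product with rotation angle `angle s` and fibre translation `shift s`. -/
noncomputable def skew (s : ℕ → Option Datum) : C(Phase, Phase) where
  toFun x := (x.1 + (angle s (homeo x.2) : ℝ),
    homeo.symm ((homeo x.2).1, (homeo x.2).2 + shift s (homeo x.2).1))
  continuous_toFun := by
    have h := homeo.continuous.comp (continuous_snd (X := AddCircle (1 : ℝ)) (Y := cantorSet))
    refine (continuous_fst.add ((AddCircle.continuous_mk' 1).comp
      ((continuous_angle s).comp h))).prodMk (homeo.symm.continuous.comp ?_)
    exact h.fst.prodMk (h.snd.add ((continuous_shift s).comp h.fst))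

theorem skew_apply (s : ℕ → Option Datum) (x : Phase) :
    skew s x = (x.1 + (angle s (homeo x.2) : ℝ),
      homeo.symm ((homeo x.2).1, (homeo x.2).2 + shift s (homeo x.2).1)) := rfl

/-- The part of the phase space that lies over the `m`-th cell. -/
def column (m : ℕ) : Set Phase := {x | (homeo x.2).1 ∈ cell m}

theorem isClopen_column (m : ℕ) : IsClopen (column m) :=
  (isClopen_cell m).preimage (homeo.continuous.comp continuous_snd).fst

theorem skew_of_mem (s : ℕ → Option Datum) {x : Phase} {m : ℕ} (hx : x ∈ column m) :
    skew s x = (x.1 + ((1 / 4 : ℝ) ^ (m + 1) * direction m (s m) (homeo x.2).2 : ℝ),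
      homeo.symm ((homeo x.2).1, (homeo x.2).2 + flip m (s m))) := by
  rw [skew_apply, angle_of_mem s hx, shift_of_mem s hx]

theorem skew_congr {s t : ℕ → Option Datum} {x : Phase} (h : ∀ m, x ∈ column m → s m = t m) :
    skew s x = skew t x := by
  rw [skew_apply, skew_apply, angle_congr h, shift_congr h]

theorem skew_mem_column_iff (s : ℕ → Option Datum) {x : Phase} {m : ℕ} :
    skew s x ∈ column m ↔ x ∈ column m := by
  simp only [column, skew_apply, Set.mem_ofPred_eq, Homeomorph.apply_symm_apply]

theorem involutive_skew (s : ℕ → Datum) : Function.Involutive (skew fun m => some (s m)) := by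
  intro x
  simp only [skew_apply, Homeomorph.apply_symm_apply, angle_add_shift, AddCircle.coe_neg,
    add_assoc, fibre_add_self, add_neg_cancel, add_zero, Prod.mk.eta,
    Homeomorph.symm_apply_apply]

/-- The index of the column that contains `x`; it is `0` if there is none. -/
noncomputable def coord (x : Phase) : ℕ := sInf {i | (homeo x.2).1 i = true}

theorem coord_of_mem {x : Phase} {m : ℕ} (hx : x ∈ column m) : coord x = m :=
  IsLeast.csInf_eq hx

/-! ### Approximation of skew products at finitely many points -/

theorem tendsto_single_true (ι : Type*) [DecidableEq ι] :
    Tendsto (fun i => (Pi.single i true : ι → Bool)) cofinite (𝓝 0) := by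
  refine tendsto_pi_nhds.2 fun j => tendsto_const_nhds.congr' ?_
  filter_upwards [eventually_cofinite_ne j] with i hi
  exact (Pi.single_eq_of_ne (M := fun _ => Bool) hi.symm true).symm

theorem single_true_injective (ι : Type*) [DecidableEq ι] :
    Function.Injective fun i => (Pi.single i true : ι → Bool) := fun i j h => by
  by_contra hij
  have hi := congrFun h i
  simp only [Pi.single_eq_same, Pi.single_eq_of_ne hij] at hi
  exact Bool.noConfusion hi

theorem eventually_exists_direction_eq_one (m : ℕ) {A : Set Fibre} (hA : A.Finite) :
    ∀ᶠ l in cofinite, ∃ W : Clopens Fibre, ∀ w ∈ A, direction m (some (l, W)) w = 1 := by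
  have hinj := (single_true_injective (ℕ × ℕ)).comp (Prod.mk_right_injective m)
  have hne : ∀ᶠ l in cofinite, ∀ w ∈ A, ∀ w' ∈ A, w' + Pi.single (m, l) true ≠ w := by
    refine hA.eventually_all.2 fun w _ => hA.eventually_all.2 fun w' _ => ?_
    filter_upwards [hinj.tendsto_cofinite.eventually (eventually_cofinite_ne (-w' + w))] with l hl h
    exact hl (eq_neg_add_of_add_eq h)
  filter_upwards [hne] with l hl
  obtain ⟨W, hW, hAW, hWA⟩ := exists_clopen_of_closed_subset_open hA.isClosed
    (hA.image (· + Pi.single (m, l) true)).isClosed.isOpen_compl (by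
      rintro w hw ⟨w', hw', h⟩
      exact hl w hw w' hw' h)
  refine ⟨⟨W, hW⟩, fun w hw => ?_⟩
  have hw' : w + Pi.single (m, l) true ∉ W := fun h => hWA h ⟨w, hw, rfl⟩
  simp [direction, flip, hAW hw, hw']

theorem eventually_dist_flip_lt (m : ℕ) (k : cantorSet) {η : ℝ} (hη : 0 < η) :
    ∀ᶠ l in cofinite,
      dist k (homeo.symm ((homeo k).1, (homeo k).2 + Pi.single (m, l) true)) < η := by
  have hflip : Tendsto (fun l => (homeo k).2 + Pi.single (m, l) true) cofinite
      (𝓝 (homeo k).2) := by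
    simpa only [add_zero, Function.comp_apply] using ((tendsto_single_true (ℕ × ℕ)).comp
      (Prod.mk_right_injective m).tendsto_cofinite).const_add (homeo k).2
  have h := (homeo.symm.continuous.tendsto _).comp
    ((tendsto_const_nhds (x := (homeo k).1)).prodMk_nhds hflip)
  simp only [Prod.mk.eta, homeo.symm_apply_apply] at h
  filter_upwards [h.eventually (Metric.ball_mem_nhds k hη)] with l hl
  exact Metric.mem_ball'.1 hl

theorem exists_dist_skew_update_le {s : ℕ → Option Datum} {m : ℕ} (hs : s m = none)
    (E : Finset Phase) {η : ℝ} (hη : 0 < η) :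
    ∃ d : Datum, ∀ x ∈ E, dist (skew s x) (skew (Function.update s m (some d)) x) ≤ η := by
  obtain ⟨l, ⟨W, hW⟩, hl⟩ := ((eventually_exists_direction_eq_one m
    (E.finite_toSet.image fun x => (homeo x.2).2)).and
    ((Finset.eventually_all E).2 fun x _ => eventually_dist_flip_lt m x.2 hη)).exists
  refine ⟨(l, W), fun x hx => ?_⟩
  by_cases hm : x ∈ column m
  · have hdir : direction m (some (l, W)) (homeo x.2).2 = direction m none (homeo x.2).2 :=
      hW _ ⟨x, hx, rfl⟩
    rw [skew_of_mem _ hm, skew_of_mem _ hm, hs, Function.update_self, hdir, Prod.dist_eq,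
      dist_self]
    refine max_le hη.le ?_
    simpa only [flip, add_zero, Prod.mk.eta, homeo.symm_apply_apply] using (hl x hx).le
  · have hfar : skew s x = skew (Function.update s m (some (l, W))) x :=
      skew_congr fun n hn => by
        have hne : n ≠ m := by rintro rfl; exact hm hn
        rw [Function.update_of_ne hne]
    rw [hfar, dist_self]
    exact hη.le

/-! ### The invariant measure and the eigenfunctions -/

/-- The Haar probability measure of the group `ι → Bool`. -/
noncomputable def coinMeasure (ι : Type*) [Countable ι] : Measure (ι → Bool) :=
  Measure.addHaarMeasure ⊤

section coinMeasure

variable {ι : Type*} [Countable ι]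

instance : (coinMeasure ι).IsAddHaarMeasure :=
  inferInstanceAs (Measure.addHaarMeasure ⊤).IsAddHaarMeasure

instance : IsProbabilityMeasure (coinMeasure ι) := ⟨Measure.addHaarMeasure_self⟩

instance [Infinite ι] : NullSingletonClass (coinMeasure ι) := by
  classical
  have h : Tendsto (fun i => (Pi.single i true : ι → Bool)) cofinite (𝓝[≠] 0) :=
    tendsto_nhdsWithin_iff.2 ⟨tendsto_single_true ι,
      (single_true_injective ι).tendsto_cofinite.eventually (eventually_cofinite_ne 0)⟩
  have : (𝓝[≠] (0 : ι → Bool)).NeBot := h.neBot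
  infer_instance

end coinMeasure

/-- The measure on the Cantor set that corresponds to the product of the Haar measures of the base
and of the fibre. -/
noncomputable def cantorMeasure : Measure cantorSet :=
  ((coinMeasure ℕ).prod (coinMeasure (ℕ × ℕ))).map homeo.symm

theorem measurePreserving_homeo_symm :
    MeasurePreserving homeo.symm ((coinMeasure ℕ).prod (coinMeasure (ℕ × ℕ))) cantorMeasure :=
  ⟨homeo.symm.continuous.measurable, rfl⟩

theorem measurePreserving_homeo :
    MeasurePreserving homeo cantorMeasure ((coinMeasure ℕ).prod (coinMeasure (ℕ × ℕ))) :=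
  measurePreserving_homeo_symm.symm homeo.symm.toMeasurableEquiv

instance : IsProbabilityMeasure cantorMeasure :=
  Measure.isProbabilityMeasure_map homeo.symm.continuous.aemeasurable

instance : NullSingletonClass cantorMeasure := ⟨fun k => by
  rw [← homeo.injective.preimage_image {k}, Set.image_singleton,
    measurePreserving_homeo.measure_preimage (measurableSet_singleton _).nullMeasurableSet,
    measure_singleton]⟩

/-- The measure on the phase space that is preserved by all skew products. -/
noncomputable abbrev skewMeasure : Measure Phase :=
  (AddCircle.haarAddCircle (T := (1 : ℝ))).prod cantorMeasure

theorem measurePreserving_skew (s : ℕ → Option Datum) :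
    MeasurePreserving (skew s) skewMeasure skewMeasure := by
  have hfibre : MeasurePreserving (fun v : Base × Fibre => (id v.1, v.2 + shift s v.1))
      ((coinMeasure ℕ).prod (coinMeasure (ℕ × ℕ))) ((coinMeasure ℕ).prod (coinMeasure (ℕ × ℕ))) :=
    (MeasurePreserving.id _).skew_product (g := fun y w => w + shift s y)
      (continuous_snd.add ((continuous_shift s).comp continuous_fst)).measurable
      (Eventually.of_forall fun y => map_add_right_eq_self _ _)
  have hcantor := measurePreserving_homeo_symm.comp (hfibre.comp measurePreserving_homeo)
  have hswapped := hcantor.skew_product (μc := AddCircle.haarAddCircle (T := (1 : ℝ)))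
    (μd := AddCircle.haarAddCircle (T := (1 : ℝ)))
    (g := fun k θ => θ + ((angle s (homeo k) : ℝ) : AddCircle (1 : ℝ)))
    (continuous_snd.add ((AddCircle.continuous_mk' 1).comp
      ((continuous_angle s).comp (homeo.continuous.comp continuous_fst)))).measurable
    (Eventually.of_forall fun k => map_add_right_eq_self _ _)
  have hskew := (Measure.measurePreserving_swap.comp hswapped).comp (Measure.measurePreserving_swap
    (μ := AddCircle.haarAddCircle (T := (1 : ℝ))) (ν := cantorMeasure))
  exact hskew

/-- An eigenfunction of the skew products that have no datum at the index `m`: over the `m`-th cell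
they rotate by `(1 / 4) ^ (m + 1)`, which this character turns into the factor `i`. -/
noncomputable def eigenfunction (m : ℕ) : Phase → ℂ :=
  (column m).indicator fun x => fourier (4 ^ m) x.1

theorem fourier_quarter (m : ℕ) :
    fourier (4 ^ m) (((1 / 4 : ℝ) ^ (m + 1) : ℝ) : AddCircle (1 : ℝ)) = Complex.I := by
  have h : (4 : ℂ) ^ m * (1 / 4) ^ (m + 1) = 1 / 4 := by
    rw [pow_succ, ← mul_assoc, ← mul_pow]
    norm_num
  rw [fourier_coe_apply]
  refine (congrArg Complex.exp ?_).trans Complex.exp_pi_div_two_mul_I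
  push_cast
  linear_combination 2 * Real.pi * Complex.I * h

theorem eigenfunction_skew {s : ℕ → Option Datum} {m : ℕ} (hs : s m = none) :
    eigenfunction m ∘ skew s = Complex.I • eigenfunction m := by
  funext x
  by_cases hx : x ∈ column m
  · have hadd (a b : AddCircle (1 : ℝ)) :
        fourier (4 ^ m) (a + b) = fourier (4 ^ m) a * fourier (4 ^ m) b := by
      simp only [fourier_apply, smul_add, AddCircle.toCircle_add, Circle.coe_mul]
    rw [Function.comp_apply, Pi.smul_apply, eigenfunction, Set.indicator_of_mem hx,
      Set.indicator_of_mem ((skew_mem_column_iff s).2 hx), skew_of_mem s hx, hs, direction,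
      Pi.one_apply, mul_one, hadd, fourier_quarter, mul_comm, smul_eq_mul]
  · rw [Function.comp_apply, Pi.smul_apply, eigenfunction, Set.indicator_of_notMem hx,
      Set.indicator_of_notMem (mt (skew_mem_column_iff s).1 hx), smul_zero]

theorem memLp_eigenfunction (p : ℝ≥0∞) (m : ℕ) : MemLp (eigenfunction m) p skewMeasure := by
  have hmeas : Measurable (eigenfunction m) :=
    ((fourier (4 ^ m)).continuous.comp continuous_fst).measurable.indicator
      (isClopen_column m).isOpen.measurableSet
  refine MemLp.of_bound hmeas.aestronglyMeasurable 1 (Eventually.of_forall fun x => ?_)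
  refine (norm_indicator_le_norm_self _ _).trans ?_
  rw [fourier_apply, Circle.norm_coe]

theorem skewMeasure_column_ne_zero (m : ℕ) : skewMeasure (column m) ≠ 0 := by
  have h : column m = Set.univ ×ˢ (homeo ⁻¹' (cell m ×ˢ Set.univ)) := by
    ext x
    simp [column]
  rw [h, Measure.prod_prod, measurePreserving_homeo.measure_preimage
    ((isClopen_cell m).isOpen.measurableSet.prod .univ).nullMeasurableSet, Measure.prod_prod]
  simpa using (isClopen_cell m).isOpen.measure_ne_zero (coinMeasure ℕ) (cell_nonempty m)

theorem eigenfunction_not_ae_eq_zero (m : ℕ) : ¬ eigenfunction m =ᵐ[skewMeasure] 0 := by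
  refine fun h => skewMeasure_column_ne_zero m (measure_mono_null (fun x hx => ?_) h)
  have hne : eigenfunction m x ≠ 0 := by
    rw [eigenfunction, Set.indicator_of_mem hx, fourier_apply]
    exact Circle.coe_ne_zero _
  exact hne

variable {p : ℝ≥0∞} [Fact (1 ≤ p)]

/-- The skew products as a family of inputs whose spectral sets lie in `𝒜` or in `ℬ` according to
whether a datum is missing. -/
noncomputable def adversarialFamily
    (spec : (Lp ℂ p skewMeasure →L[ℂ] Lp ℂ p skewMeasure) → NonemptyCompacts ℂ)
    {S : Set C(Phase, Phase)} (hS : S ⊆ generalClass p skewMeasure)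
    (hmp : measurePreservingClass skewMeasure ⊆ S) (𝒜 ℬ : Set (NonemptyCompacts ℂ))
    (hmem : ∀ T : Lp ℂ p skewMeasure →L[ℂ] Lp ℂ p skewMeasure, Module.End.HasEigenvalue
      (T : Lp ℂ p skewMeasure →ₗ[ℂ] Lp ℂ p skewMeasure) Complex.I → spec T ∈ 𝒜)
    (hsub : ∀ T : Lp ℂ p skewMeasure →L[ℂ] Lp ℂ p skewMeasure,
      Function.Involutive T → (∀ f, ‖T f‖ ≤ ‖f‖) → spec T ∈ ℬ) :
    (koopmanProblem spec S hS).AdversarialFamily Datum 𝒜 ℬ where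
  input s := ⟨skew s, hmp (measurePreserving_skew s).map_eq⟩
  coord := coord
  eval_congr _ _ _ h := skew_congr fun m hm => by rwa [coord_of_mem hm] at h
  xi_mem_of_none _ m hs := hmem _ (hasEigenvalue_koopman _ (memLp_eigenfunction p m)
    (eigenfunction_not_ae_eq_zero m) (Eventually.of_forall (congrFun (eigenfunction_skew hs))))
  xi_mem_of_some s := hsub _ (involutive_koopman _ (involutive_skew s)) fun f =>
    (norm_koopman _ (measurePreserving_skew _).map_eq f).le
  exists_approx _ _ hs E _ hη := exists_dist_skew_update_le hs E hη

theorem not_sigmaApEps_inDelta_two {ε : ℝ} (hε : 0 < ε) {S : Set C(Phase, Phase)}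
    (hS : S ⊆ generalClass p skewMeasure) (hmp : measurePreservingClass skewMeasure ⊆ S) :
    ¬ (koopmanProblem (sigmaApEpsCompact ε hε) S hS).delta1.InDelta 2 := by
  let z : ℂ := ((1 + ε : ℝ) : ℂ) * Complex.I
  have hz : z ∈ Metric.closedBall Complex.I ε := by
    have : z - Complex.I = ε * Complex.I := by
      simp only [z]
      push_cast
      ring
    rw [mem_closedBall_iff_norm, this, norm_mul, Complex.norm_I, mul_one,
      Complex.norm_of_nonneg hε.le]
  exact CompProblem.not_inDelta_two_of_adversarialFamily
    (adversarialFamily (sigmaApEpsCompact ε hε) hS hmp {K | z ∈ K}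
      {K | (K : Set ℂ) ⊆ involutionBound ε}
      (fun _ h => closedBall_subset_sigmaApEps h hε hz)
      fun _ h h' => sigmaApEps_subset_involutionBound h h' ε)
    (CompProblem.separatedNhds_mem_subset (isClosed_involutionBound ε)
      (mul_I_notMem_involutionBound (t := 1 + ε) (by positivity) (by linarith)))

theorem not_sigmaAp_inPi_two {S : Set C(Phase, Phase)} (hS : S ⊆ generalClass p skewMeasure)
    (hmp : measurePreservingClass skewMeasure ⊆ S) :
    ¬ (koopmanProblem sigmaApCompact S hS).delta1.InPi 2 := by
  have hI : Complex.I ∉ involutionBound (1 / 2) := by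
    simpa using mul_I_notMem_involutionBound (t := 1) (ε := 1 / 2) zero_le_one (by norm_num)
  exact CompProblem.not_inPi_two_of_adversarialFamily (isClosed_involutionBound (1 / 2)) hI
    (adversarialFamily sigmaApCompact hS hmp _ _ (fun _ h => mem_sigmaAp_of_hasEigenvalue h)
      fun T h h' => (sigmaAp_subset_sigmaApEps one_half_pos T).trans
        (sigmaApEps_subset_involutionBound h h' _))

end CantorSkew

theorem corollary5p8_general :
    (∀ (p : ℝ≥0∞) [Fact (1 ≤ p)], p ≠ ∞ →
      ∀ (ε : ℝ) (hε : 0 < ε) (X : Type*) [MetricSpace X] [CompactSpace X] [MeasurableSpace X]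
        [BorelSpace X] (ω : Measure X) [IsFiniteMeasure ω] [NeZero ω]
        (S : Set C(X, X)) (hS : S ⊆ generalClass p ω),
        (koopmanProblem (sigmaApEpsCompact ε hε) S hS).delta1.InSigma 2 ∧
        (koopmanProblem sigmaApCompact S hS).delta1.InPi 3) ∧
    ∃ (ν : Measure cantorSet) (_ : IsProbabilityMeasure ν) (_ : NullSingletonClass ν),
      ∀ (p : ℝ≥0∞) [Fact (1 ≤ p)] (ε : ℝ) (hε : 0 < ε)
        (S : Set C(AddCircle (1 : ℝ) × cantorSet, AddCircle (1 : ℝ) × cantorSet))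
        (hS : S ⊆ generalClass p ((AddCircle.haarAddCircle (T := (1 : ℝ))).prod ν)),
        measurePreservingClass ((AddCircle.haarAddCircle (T := (1 : ℝ))).prod ν) ⊆ S →
        ¬ (koopmanProblem (sigmaApEpsCompact ε hε) S hS).delta1.InDelta 2 ∧
        ¬ (koopmanProblem sigmaApCompact S hS).delta1.InPi 2 :=
  ⟨fun _ _ hp _ hε _ _ _ _ _ _ _ _ _ hS =>
      ⟨koopmanProblem_sigmaApEps_inSigma_two hp hε hS, koopmanProblem_sigmaAp_inPi_three hp hS⟩,
    CantorSkew.cantorMeasure, inferInstance, inferInstance, fun _ _ _ hε _ hS hmp =>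
      ⟨CantorSkew.not_sigmaApEps_inDelta_two hε hS hmp, CantorSkew.not_sigmaAp_inPi_two hS hmp⟩⟩

theorem corollary5p8 :
    (∀ (p : ℝ≥0∞) [Fact (1 ≤ p)], 1 < p → p ≠ 2 → p < ∞ →
      ∀ (ε : ℝ) (hε : 0 < ε) (X : Type*) [MetricSpace X] [CompactSpace X] [MeasurableSpace X]
        [BorelSpace X] (ω : Measure X) [IsFiniteMeasure ω] [NeZero ω],
        (apEpsMeasurePreserving p ω ε hε).InSigma 2 ∧
        (apMeasurePreserving p ω).InPi 3 ∧
        (apEpsGeneral p ω ε hε).InSigma 2 ∧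
        (apGeneral p ω).InPi 3) ∧
    ∃ (ν : Measure cantorSet) (_ : IsProbabilityMeasure ν) (_ : NullSingletonClass ν),
      ∀ (p : ℝ≥0∞) [Fact (1 ≤ p)], 1 < p → p ≠ 2 → p < ∞ →
      ∀ (ε : ℝ) (hε : 0 < ε),
        ¬ (apEpsMeasurePreserving p ((AddCircle.haarAddCircle (T := (1 : ℝ))).prod ν) ε hε).InSigma 1 ∧
        ¬ (apMeasurePreserving p ((AddCircle.haarAddCircle (T := (1 : ℝ))).prod ν)).InPi 2 ∧
        ¬ (apEpsGeneral p ((AddCircle.haarAddCircle (T := (1 : ℝ))).prod ν) ε hε).InSigma 1 ∧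
        ¬ (apGeneral p ((AddCircle.haarAddCircle (T := (1 : ℝ))).prod ν)).InPi 2 := by
  obtain ⟨upper, ν, hν, hν₀, lower⟩ := corollary5p8_general
  refine ⟨fun p _ _ _ hp ε hε X _ _ _ _ ω _ _ => ?_, ν, hν, hν₀, fun p _ _ _ _ ε hε => ?_⟩
  · obtain ⟨hσ, hπ⟩ := upper p hp.ne ε hε X ω _ (measurePreservingClass_subset p ω)
    exact ⟨hσ, hπ, upper p hp.ne ε hε X ω _ subset_rfl⟩
  · obtain ⟨hσ, hπ⟩ := lower p ε hε _ (measurePreservingClass_subset p _) subset_rfl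
    obtain ⟨hσ', hπ'⟩ := lower p ε hε _ subset_rfl (measurePreservingClass_subset p _)
    exact ⟨fun h => hσ h.1, hπ, fun h => hσ' h.1, hπ'⟩
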